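/- Let $k$ be a field, $S=k[x_1,\dots,x_n]$ with its $\mathbb N^n$-grading, and let $M=\bigoplus_{d\in\mathbb N^n}M_d$ be a finitely generated $\mathbb N^n$-graded $S$-module. **Notation.** Write $e_i$ for the $i$-th unit vector and $\operatorname{supp}(d)=\{i: d_i\neq 0\}$. For $c\in\mathbb N^n$, $M$ is *positively $c$-determined* if it is finitely generated and multiplication by $x_i$ is a bijection $M_d\to M_{d+e_i}$ whenever $d_i\ge c_i$. The *Alexander dual* $\mathcal A_c(M)$ is the $\mathbb N^n$-graded $S$-module with $\mathcal A_c(M)_d=\operatorname{Hom}_k(M_{c-(d\wedge c)},k)$, where $\wedge$ is the coordinatewise minimum, and where multiplication by $x_i$ from degree $d$ to degree $d+e_i$ is the $k$-dual of the multiplication map $M_{c-((d+e_i)\wedge c)}\to M_{c-(d\wedge c)}$ of $M$ (by $x_i$ if $d_i<c_i$, the identity if $d_i\ge c_i$). For $a,b\in\mathbb N^n$, $a\triangleleft b\in\mathbb N^n$ has $i$-th coordinate $a_i+b_i$ if $a_i\ne0$ and $0$ if $a_i=0$. **Invariants.** - $\beta_{i,a}(M)=\dim_k\operatorname{Tor}_i^S(k,M)_a$.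 - $\dim_S M$ is the Krull dimension of $M$, and $\operatorname{depth}M$ is the supremum of the lengths of $M$-regular sequences in $(x_1,\dots,x_n)$. - $\operatorname{sreg}M=\max\{\#\operatorname{supp}(a)-i : \beta_{i,a}(M)\ne0\}$. - A *Stanley decomposition* of $M$ is a finite direct sum decomposition $M=\bigoplus_j m_j\,k[Z_j]$ of $k$-vector spaces with $m_j$ homogeneous, $Z_j\subseteq\{x_1,\dots,x_n\}$, and $m_j\,k[Z_j]$ a free $k[Z_j]$-module with basis $m_j$. $\operatorname{sdepth}M$ is the maximum over all Stanley decompositions of $\min_j\#Z_j$. - For $c\le b'\le a$ in $\mathbb N^n$ (coordinatewise) let $k_a[c,b']$ be the ideal generated by $x^c$ in $S/(x_i^{b'_i+1} : b'_i<a_i)$; it has as $k$-basis the monomials $\bar x^d$ with $d\ge c$ and $d_i\le b'_i$ whenever $b'_i<a_i$. A *quasi Stanley decomposition* of $M$ consists of some $a\in\mathbb N^n$, finitely many pairs $c_j\le b'_j\le a$, and a graded $k$-linear bijection $f:\bigoplus_j k_a[c_j,b'_j]\to M$ with $f(\bar x^d)=x^{d-c_j}f(\bar x^{c_j})$ for every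 basis monomial $\bar x^d$ of the $j$-th summand. $\operatorname{shreg}M$ is the minimum over all quasi Stanley decompositions of $\max_j\#\operatorname{supp}(c_j)$. (For $M=0$ a maximum, minimum or supremum over the empty set is given its conventional value as a supremum or infimum.) **Proposition.** There is $c\in\mathbb N^n$ such that $M$ is positively $c$-determined. For every such $c$ and every $b\in\mathbb N^n$, the module $M^{\triangleleft b}:=\mathcal A_{b+c}(\mathcal A_c(M))$ satisfies $$\beta_{i,a}(M)=\beta_{i,a\triangleleft b}(M^{\triangleleft b})\quad\text{for all } i\in\mathbb N,\ a\in\mathbb N^n,$$ $$\dim_S M=\dim_S M^{\triangleleft b},\quad \operatorname{depth}M=\operatorname{depth}M^{\triangleleft b},\quad \operatorname{sreg}M=\operatorname{sreg}M^{\triangleleft b},$$ $$\operatorname{sdepth}M=\operatorname{sdepth}M^{\triangleleft b},\quad \operatorname{shreg}M=\operatorname{shreg}M^{\triangleleft b}.$$ -/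

import Mathlib

open scoped DirectSum

/-- An `ℕⁿ`-graded module `M = ⨁_{d ∈ ℕⁿ} M_d` over the polynomial ring `S = k[x₁, …, xₙ]`
(equivalently: a `ℤⁿ`-graded module whose components of degree outside `ℕⁿ` vanish).
No finiteness is built in. -/
structure NGradedModule (k : Type*) [Field k] (n : ℕ) where
  carrier : Type*
  [addCommGroup : AddCommGroup carrier]
  [moduleBase : Module k carrier]
  [modulePoly : Module (MvPolynomial (Fin n) k) carrier]
  [scalarTower : IsScalarTower k (MvPolynomial (Fin n) k) carrier]
  /-- The homogeneous component of degree `d`. -/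
  piece : (Fin n →₀ ℕ) → Submodule k carrier
  isInternal : DirectSum.IsInternal piece
  /-- `x^d • M_e ⊆ M_{d+e}`. -/
  monomial_smul_mem : ∀ (d e : Fin n →₀ ℕ), ∀ m ∈ piece e,
    (MvPolynomial.monomial d (1 : k)) • m ∈ piece (d + e)

namespace NGradedModule

attribute [instance] addCommGroup moduleBase modulePoly scalarTower

instance coeSortCarrier {k : Type*} [Field k] {n : ℕ} : CoeSort (NGradedModule k n) (Type _) :=
  ⟨carrier⟩

section Basic

variable {k : Type*} [Field k] {n : ℕ} (M : NGradedModule k n)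

/-- `M` is positively `a`-determined: it is finitely generated, and multiplication by `x_i` is a
bijection `M_d → M_{d + e_i}` whenever `d_i ≥ a_i`. -/
def IsPosDetermined (a : Fin n →₀ ℕ) : Prop :=
  Module.Finite (MvPolynomial (Fin n) k) M ∧
    ∀ (d : Fin n →₀ ℕ) (i : Fin n), a i ≤ d i →
      Set.BijOn (fun m : M => (MvPolynomial.X i : MvPolynomial (Fin n) k) • m)
        (M.piece d) (M.piece (d + Finsupp.single i 1))

/-! ### Alexander duality -/

/-- For `p ≤ q`, multiplication by `x^{q-p}` as a map `M_p → M_q`. -/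
noncomputable def mulMap {p q : Fin n →₀ ℕ} (h : p ≤ q) : M.piece p →ₗ[k] M.piece q where
  toFun m := ⟨MvPolynomial.monomial (q - p) (1 : k) • (m : M), by
    have := M.monomial_smul_mem (q - p) p m m.2
    rwa [tsub_add_cancel_of_le h] at this⟩
  map_add' x y := by ext; simp
  map_smul' r x := by
    ext
    simp only [Submodule.coe_smul, RingHom.id_apply]
    rw [smul_algebra_smul_comm]

theorem mulMap_refl {p : Fin n →₀ ℕ} (h : p ≤ p) : M.mulMap h = LinearMap.id := by
  ext x
  simp [mulMap]

theorem mulMap_comp {p q r : Fin n →₀ ℕ} (h : p ≤ q) (h' : q ≤ r) :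
    M.mulMap h' ∘ₗ M.mulMap h = M.mulMap (h.trans h') := by
  ext x
  simp only [mulMap, LinearMap.comp_apply, LinearMap.coe_mk, AddHom.coe_mk]
  rw [← mul_smul, MvPolynomial.monomial_mul, one_mul, tsub_add_tsub_cancel h' h]

/-- The component of degree `d` of the Alexander dual of `M` with respect to `c`: it is
`Hom_k(M_{c-d}, k)` for `d ≤ c`; for arbitrary `d ∈ ℕⁿ` it is the one of degree `d ∧ c`, that is
`Hom_k(M_{c - (d ∧ c)}, k)`, and `c - (d ∧ c)` is the truncated difference. -/
def AlexComp (c d : Fin n →₀ ℕ) : Type _ := Module.Dual k (M.piece (c - d))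

noncomputable instance instAddCommGroupAlexComp (c d : Fin n →₀ ℕ) :
    AddCommGroup (M.AlexComp c d) :=
  inferInstanceAs (AddCommGroup (Module.Dual k (M.piece (c - d))))

noncomputable instance instModuleAlexComp (c d : Fin n →₀ ℕ) : Module k (M.AlexComp c d) :=
  inferInstanceAs (Module k (Module.Dual k (M.piece (c - d))))

/-- The underlying vector space of the Alexander dual of `M` with respect to `c`. -/
abbrev AlexCarrier (c : Fin n →₀ ℕ) : Type _ :=
  ⨁ d : Fin n →₀ ℕ, M.AlexComp c d

/-- The `k`-dual `Hom_k(M_{c-d}, k) → Hom_k(M_{c-e}, k)` of the multiplication map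
`M_{c - e} → M_{c - d}` for `d ≤ e`. -/
noncomputable def alexCompMap (c : Fin n →₀ ℕ) {d e : Fin n →₀ ℕ} (h : d ≤ e) :
    M.AlexComp c d →ₗ[k] M.AlexComp c e :=
  (M.mulMap (tsub_le_tsub_left h c)).dualMap

theorem alexCompMap_refl (c : Fin n →₀ ℕ) {d : Fin n →₀ ℕ} (h : d ≤ d) :
    M.alexCompMap c h = LinearMap.id := by
  rw [alexCompMap, mulMap_refl]
  rfl

theorem alexCompMap_comp (c : Fin n →₀ ℕ) {d e f : Fin n →₀ ℕ} (h : d ≤ e) (h' : e ≤ f) :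
    M.alexCompMap c h' ∘ₗ M.alexCompMap c h = M.alexCompMap c (h.trans h') := by
  have := M.mulMap_comp (tsub_le_tsub_left h' c) (tsub_le_tsub_left h c)
  rw [alexCompMap, alexCompMap, alexCompMap, ← this]
  rfl

/-- Multiplication by `x^e` on the Alexander dual: on the component of degree `d` it is the
`k`-dual of the multiplication map `M_{c - (e + d)} → M_{c - d}`. -/
noncomputable def alexMul (c e : Fin n →₀ ℕ) : M.AlexCarrier c →ₗ[k] M.AlexCarrier c :=
  DirectSum.toModule k _ _ fun d =>
    DirectSum.lof k _ (M.AlexComp c) (e + d) ∘ₗ M.alexCompMap c (le_add_self : d ≤ e + d)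

theorem alexMul_lof (c e d : Fin n →₀ ℕ) (φ : M.AlexComp c d) :
    M.alexMul c e (DirectSum.lof k _ (M.AlexComp c) d φ) =
      DirectSum.lof k _ (M.AlexComp c) (e + d)
        (M.alexCompMap c (le_add_self : d ≤ e + d) φ) := by
  simp [alexMul]

theorem lof_alexCompMap_congr (c : Fin n →₀ ℕ) {d e e' : Fin n →₀ ℕ} (h : e = e')
    (he : d ≤ e) (he' : d ≤ e') (φ : M.AlexComp c d) :
    DirectSum.lof k _ (M.AlexComp c) e (M.alexCompMap c he φ) =
      DirectSum.lof k _ (M.AlexComp c) e' (M.alexCompMap c he' φ) := by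
  subst h
  rfl

theorem alexMul_zero (c : Fin n →₀ ℕ) : M.alexMul c 0 = LinearMap.id := by
  refine DirectSum.linearMap_ext k fun d => LinearMap.ext fun φ => ?_
  rw [LinearMap.comp_apply, alexMul_lof,
    M.lof_alexCompMap_congr c (zero_add d) _ le_rfl φ, alexCompMap_refl]
  rfl

theorem alexMul_add (c e f : Fin n →₀ ℕ) :
    M.alexMul c (e + f) = M.alexMul c e ∘ₗ M.alexMul c f := by
  refine DirectSum.linearMap_ext k fun d => LinearMap.ext fun φ => ?_
  simp only [LinearMap.comp_apply]
  rw [alexMul_lof, alexMul_lof, alexMul_lof, ← LinearMap.comp_apply (M.alexCompMap c _),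
    alexCompMap_comp]
  exact M.lof_alexCompMap_congr c (add_assoc e f d) _ _ φ

/-- The `S`-action on the Alexander dual, extending `x^e ↦ alexMul c e` linearly. -/
noncomputable def alexAction (c : Fin n →₀ ℕ) :
    MvPolynomial (Fin n) k →ₐ[k] Module.End k (M.AlexCarrier c) :=
  AddMonoidAlgebra.lift k (Module.End k (M.AlexCarrier c)) (Fin n →₀ ℕ)
    { toFun := fun e => M.alexMul c e.toAdd
      map_one' := M.alexMul_zero c
      map_mul' := fun e f => M.alexMul_add c e.toAdd f.toAdd }

theorem alexAction_monomial (c e : Fin n →₀ ℕ) :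
    M.alexAction c (MvPolynomial.monomial e 1) = M.alexMul c e := by
  simp [alexAction, MvPolynomial.monomial]

/-- The `S`-module structure on the Alexander dual. -/
@[reducible]
noncomputable def alexModule (c : Fin n →₀ ℕ) :
    Module (MvPolynomial (Fin n) k) (M.AlexCarrier c) :=
  Module.compHom _ (M.alexAction c).toRingHom

theorem alexScalarTower (c : Fin n →₀ ℕ) :
    letI := M.alexModule c
    IsScalarTower k (MvPolynomial (Fin n) k) (M.AlexCarrier c) :=
  letI := M.alexModule c
  ⟨fun r f x => by
    change M.alexAction c (r • f) x = r • M.alexAction c f x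
    rw [map_smul, LinearMap.smul_apply]⟩

/-- The component of degree `d` of the Alexander dual. -/
noncomputable def alexPiece (c d : Fin n →₀ ℕ) : Submodule k (M.AlexCarrier c) :=
  LinearMap.range (DirectSum.lof k _ (M.AlexComp c) d)

theorem alexPiece_isInternal (c : Fin n →₀ ℕ) : DirectSum.IsInternal (M.alexPiece c) := by
  refine DirectSum.isInternal_submodule_of_iSupIndep_of_iSup_eq_top ?_ ?_
  · intro d
    rw [Submodule.disjoint_def]
    rintro _ ⟨φ, rfl⟩ hx
    have hle : (⨆ (j) (_ : j ≠ d), M.alexPiece c j) ≤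
        LinearMap.ker (DirectSum.component k _ (M.AlexComp c) d) := by
      refine iSup₂_le fun j hj => ?_
      rintro _ ⟨ψ, rfl⟩
      rw [LinearMap.mem_ker, DirectSum.component.of, dif_neg hj]
    have := hle hx
    rw [LinearMap.mem_ker, DirectSum.component.lof_self] at this
    rw [this, map_zero]
  · exact DFinsupp.iSup_range_lsingle

theorem alexPiece_monomial_smul_mem (c d e : Fin n →₀ ℕ) (m : M.AlexCarrier c)
    (hm : m ∈ M.alexPiece c e) :
    M.alexAction c (MvPolynomial.monomial d 1) m ∈ M.alexPiece c (d + e) := by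
  obtain ⟨φ, rfl⟩ := hm
  rw [alexAction_monomial, alexMul_lof]
  exact ⟨_, rfl⟩

/-- The Alexander dual `A_c(M)`. -/
noncomputable def alexDual (c : Fin n →₀ ℕ) : NGradedModule k n where
  carrier := M.AlexCarrier c
  modulePoly := M.alexModule c
  scalarTower := M.alexScalarTower c
  piece := M.alexPiece c
  isInternal := M.alexPiece_isInternal c
  monomial_smul_mem := fun d e m hm => M.alexPiece_monomial_smul_mem c d e m hm

/-- `M^{◁ b} = A_{b+c}(A_c(M))`, formed with the auxiliary degree `c` (to be used when `M` is
positively `c`-determined). -/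
noncomputable def slide (c b : Fin n →₀ ℕ) : NGradedModule k n :=
  (M.alexDual c).alexDual (b + c)

/-! ### Graded Betti numbers -/

/-- The vector `∑_{i ∈ F} e_i`. -/
noncomputable def indicator (F : Finset (Fin n)) : Fin n →₀ ℕ :=
  ∑ i ∈ F, Finsupp.single i 1

/-- The degree `b` part of the `i`-th term `K_i ⊗_S M` of the Koszul complex, where `K_•` is the
Koszul complex of `x₁, …, xₙ`, i.e. the `ℤⁿ`-graded free resolution of `k = S/(x₁, …, xₙ)` with
`K_i = ⨁_{#F = i} S(-∑_{j ∈ F} e_j)`. So this is `⨁_{#F = i} M_{b - ∑_{j ∈ F} e_j}`, where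
the components of degree outside `ℕⁿ` are zero. -/
noncomputable def koszulChains (i : ℕ) (b : Fin n →₀ ℕ) :
    Submodule k (Finset (Fin n) → M) :=
  Submodule.pi Set.univ fun F =>
    if F.card = i ∧ indicator F ≤ b then M.piece (b - indicator F) else ⊥

/-- The Koszul differential, `e_F ⊗ m ↦ ∑_{j ∈ F} (-1)^{#{l ∈ F, l < j}} e_{F ∖ j} ⊗ x_j m`. -/
noncomputable def koszulD : (Finset (Fin n) → M) →ₗ[k] (Finset (Fin n) → M) where
  toFun u G := ∑ j ∈ Gᶜ, (-1 : k) ^ (G.filter (· < j)).card •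
    ((MvPolynomial.X j : MvPolynomial (Fin n) k) • u (insert j G))
  map_add' u v := by
    funext G
    simp [smul_add, Finset.sum_add_distrib]
  map_smul' r u := by
    funext G
    simp only [Pi.smul_apply, RingHom.id_apply, Finset.smul_sum]
    refine Finset.sum_congr rfl fun j _ => ?_
    rw [← smul_algebra_smul_comm r, smul_comm r]

/-- The cycles of `(K_i ⊗_S M)_b`. -/
noncomputable def koszulCycles (i : ℕ) (b : Fin n →₀ ℕ) : Submodule k (Finset (Fin n) → M) :=
  M.koszulChains i b ⊓ LinearMap.ker M.koszulD

/-- The boundaries in `(K_i ⊗_S M)_b`. -/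
noncomputable def koszulBoundaries (i : ℕ) (b : Fin n →₀ ℕ) :
    Submodule k (Finset (Fin n) → M) :=
  (M.koszulChains (i + 1) b).map M.koszulD

theorem koszulD_koszulD (u : Finset (Fin n) → M) : M.koszulD (M.koszulD u) = 0 := by
  funext G
  simp only [koszulD, LinearMap.coe_mk, AddHom.coe_mk, Finset.smul_sum, Pi.zero_apply]
  rw [Finset.sum_sigma']
  refine Finset.sum_involution (fun p _ => ⟨p.2, p.1⟩) ?_ ?_ ?_ ?_
  · rintro ⟨j, l⟩ h
    simp only [Finset.mem_sigma, Finset.mem_compl, Finset.mem_insert, not_or] at h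
    obtain ⟨hj, hlj, hl⟩ := h
    have key : ∀ p q : Fin n, p ∉ G → q ∉ G → p < q →
        (-1 : k) ^ (G.filter (· < p)).card * (-1 : k) ^ ((insert p G).filter (· < q)).card =
        -((-1 : k) ^ (G.filter (· < q)).card *
          (-1 : k) ^ ((insert q G).filter (· < p)).card) := by
      intro p q hp hq hpq
      rw [Finset.filter_insert, if_pos hpq, Finset.filter_insert, if_neg hpq.not_gt,
        Finset.card_insert_of_notMem (by simp [hp])]
      ring
    have key' : (-1 : k) ^ (G.filter (· < j)).card * (-1 : k) ^ ((insert j G).filter (· < l)).card =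
        -((-1 : k) ^ (G.filter (· < l)).card *
          (-1 : k) ^ ((insert l G).filter (· < j)).card) := by
      rcases lt_or_gt_of_ne hlj with h | h
      · rw [key l j hl hj h, neg_neg]
      · exact key j l hj hl h
    dsimp only
    rw [smul_algebra_smul_comm ((-1 : k) ^ ((insert j G).filter (· < l)).card)
        (MvPolynomial.X j : MvPolynomial (Fin n) k),
      smul_algebra_smul_comm ((-1 : k) ^ ((insert l G).filter (· < j)).card)
        (MvPolynomial.X l : MvPolynomial (Fin n) k), smul_smul ((-1 : k) ^ _),
      smul_smul ((-1 : k) ^ _), key', Finset.insert_comm l j,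
      smul_comm (MvPolynomial.X j : MvPolynomial (Fin n) k), neg_smul, neg_add_cancel]
  · rintro ⟨j, l⟩ h _ h'
    simp only [Finset.mem_sigma, Finset.mem_compl, Finset.mem_insert, not_or] at h
    simp only [Sigma.mk.injEq] at h'
    exact h.2.1 h'.1
  · rintro ⟨j, l⟩ h
    simp only [Finset.mem_sigma, Finset.mem_compl, Finset.mem_insert, not_or] at h ⊢
    exact ⟨h.2.2, fun e => h.2.1 e.symm, h.1⟩
  · rintro ⟨j, l⟩ _
    rfl

theorem koszulD_mem_chains {i : ℕ} {b : Fin n →₀ ℕ} {u : Finset (Fin n) → M}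
    (hu : u ∈ M.koszulChains (i + 1) b) : M.koszulD u ∈ M.koszulChains i b := by
  simp only [koszulChains, Submodule.mem_pi, Set.mem_univ, true_imp_iff] at hu ⊢
  intro G
  simp only [koszulD, LinearMap.coe_mk, AddHom.coe_mk]
  refine Submodule.sum_mem _ fun j hj => Submodule.smul_mem _ _ ?_
  rw [Finset.mem_compl] at hj
  have hi : indicator (insert j G) = Finsupp.single j 1 + indicator G := by
    rw [indicator, Finset.sum_insert hj]; rfl
  have h := hu (insert j G)
  rw [Finset.card_insert_of_notMem hj, hi] at h
  split_ifs at h with h1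
  · have hG : indicator G ≤ b := le_add_self.trans h1.2
    rw [if_pos ⟨Nat.succ_injective h1.1, hG⟩]
    have := M.monomial_smul_mem (Finsupp.single j 1) _ _ h
    rwa [add_comm (Finsupp.single j 1) (indicator G), ← tsub_tsub,
      add_tsub_cancel_of_le] at this
    refine (le_tsub_iff_right hG).2 h1.2
  · rw [(Submodule.mem_bot k).1 h, smul_zero]
    exact Submodule.zero_mem _

/-- The Koszul differentials square to zero. -/
theorem koszulBoundaries_le_koszulCycles (i : ℕ) (b : Fin n →₀ ℕ) :
    M.koszulBoundaries i b ≤ M.koszulCycles i b := by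
  rintro _ ⟨u, hu, rfl⟩
  exact ⟨M.koszulD_mem_chains hu, M.koszulD_koszulD u⟩

/-- `Tor_i^S(k, M)_b`, computed from the graded free resolution `K_•` of `k`: the homology
`H_i(K_• ⊗_S M)_b`. -/
abbrev TorPiece (i : ℕ) (b : Fin n →₀ ℕ) : Type _ :=
  M.koszulCycles i b ⧸ (M.koszulBoundaries i b).comap (M.koszulCycles i b).subtype

/-- The graded Betti number `β_{i,b}(M) = dim_k Tor_i^S(k, M)_b`. -/
noncomputable def betti (i : ℕ) (b : Fin n →₀ ℕ) : ℕ :=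
  Module.finrank k (M.TorPiece i b)

/-- The support regularity `sreg M = max {#supp(b) - i | β_{i,b}(M) ≠ 0}`; the differences are
integers, and `⊥ = -∞` is the value for `M = 0`. -/
noncomputable def sreg : EReal :=
  ⨆ (i : ℕ) (b : Fin n →₀ ℕ) (_ : M.betti i b ≠ 0), (((b.support.card : ℝ) - (i : ℝ) : ℝ) : EReal)

/-! ### Dimension and depth -/

/-- The Krull dimension `dim_S M` (`⊥` for `M = 0`). -/
noncomputable def dim : WithBot ℕ∞ :=
  Module.supportDim (MvPolynomial (Fin n) k) M

/-- The depth of `M`: the supremum of the lengths of `M`-regular sequences in the graded maximal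
ideal `(x₁, …, xₙ)`. -/
noncomputable def depth : ℕ∞ :=
  ⨆ (rs : List (MvPolynomial (Fin n) k))
    (_ : (∀ r ∈ rs, r ∈ Ideal.span (Set.range
      (MvPolynomial.X : Fin n → MvPolynomial (Fin n) k))) ∧
      RingTheory.Sequence.IsRegular M rs), (rs.length : ℕ∞)

/-! ### Stanley decompositions -/

/-- The `k`-subspace `m k[Z]` of `M`, where `k[Z] ⊆ S` is the polynomial subalgebra generated by
the variables in `Z`. -/
noncomputable def stanleySpace (m : M) (Z : Finset (Fin n)) : Submodule k M :=
  (Subalgebra.toSubmodule (MvPolynomial.supported k (Z : Set (Fin n)))).map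
    ((LinearMap.toSpanSingleton (MvPolynomial (Fin n) k) M m).restrictScalars k)

/-- A Stanley decomposition `M = ⨁_j m_j k[Z_j]` with homogeneous `m_j` such that `m_j k[Z_j]`
is a free `k[Z_j]`-module on `m_j`. -/
structure StanleyDecomposition where
  size : ℕ
  gen : Fin size → M
  Z : Fin size → Finset (Fin n)
  homogeneous : ∀ j, ∃ d, gen j ∈ M.piece d
  free : ∀ j, ∀ f ∈ MvPolynomial.supported k (Z j : Set (Fin n)), f • gen j = 0 → f = 0
  isInternal : DirectSum.IsInternal fun j => M.stanleySpace (gen j) (Z j)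

/-- The Stanley depth `min_j #Z_j` of a decomposition (`∞` for the empty decomposition of `0`). -/
noncomputable def StanleyDecomposition.sdepth {M : NGradedModule k n}
    (D : M.StanleyDecomposition) : ℕ∞ :=
  ⨅ j, ((D.Z j).card : ℕ∞)

/-- The Stanley depth of `M`: the maximum of the Stanley depths of its decompositions. -/
noncomputable def sdepth : ℕ∞ :=
  ⨆ D : M.StanleyDecomposition, D.sdepth

/-! ### Quasi Stanley decompositions -/

/-- The set `⟦c, b⟧_a` of degrees `d` with `k_a[c, b]_d ≠ 0`, where `c ≤ b ≤ a` and `k_a[c, b]` is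
the ideal generated by `x^c` in `S/(x_i^{b_i + 1} | b_i < a_i)`. As a graded vector space,
`k_a[c, b]` has the monomials `x^d` with `d ∈ ⟦c, b⟧_a` as a basis. -/
def block (a c b : Fin n →₀ ℕ) : Set (Fin n →₀ ℕ) :=
  {d | c ≤ d ∧ ∀ i, b i < a i → d i ≤ b i}

/-- A positively `a`-determined quasi Stanley decomposition of `M`: vectors `c_j ≤ b_j ≤ a` and a
graded `k`-linear bijection `f : ⨁_j k_a[c_j, b_j] → M` such that `f(x^d) = x^{d - c_j} f(x^{c_j})`
for all `d ∈ ⟦c_j, b_j⟧_a`. The bijection is recorded as the `k`-basis `(f(x^d))_{j, d}` of `M`. -/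
structure QuasiStanleyDecomposition (a : Fin n →₀ ℕ) where
  size : ℕ
  lower : Fin size → (Fin n →₀ ℕ)
  upper : Fin size → (Fin n →₀ ℕ)
  lower_le_upper : ∀ j, lower j ≤ upper j
  upper_le : ∀ j, upper j ≤ a
  f : Module.Basis (Σ j, block a (lower j) (upper j)) k M
  graded : ∀ (j : Fin size) (d : block a (lower j) (upper j)), f ⟨j, d⟩ ∈ M.piece d
  f_eq : ∀ (j : Fin size) (d d₀ : block a (lower j) (upper j)), (d₀ : Fin n →₀ ℕ) = lower j →
    f ⟨j, d⟩ = MvPolynomial.monomial ((d : Fin n →₀ ℕ) - lower j) (1 : k) • f ⟨j, d₀⟩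

/-- `max_j #supp(c_j)` for a quasi Stanley decomposition. -/
noncomputable def QuasiStanleyDecomposition.shreg {M : NGradedModule k n} {a : Fin n →₀ ℕ}
    (D : M.QuasiStanleyDecomposition a) : ℕ∞ :=
  ⨆ j, ((D.lower j).support.card : ℕ∞)

/-- `shreg M`: the minimum of `shreg D` over all quasi Stanley decompositions `D` of `M`
(positively `a`-determined for any `a`). -/
noncomputable def shreg : ℕ∞ :=
  ⨅ (a : Fin n →₀ ℕ) (D : M.QuasiStanleyDecomposition a), D.shreg

end Basic

/-- The vector `a ◁ b`: its `i`-th coordinate is `a_i + b_i` if `a_i ≠ 0`, and `0` otherwise. -/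
noncomputable def slideDeg {n : ℕ} (a b : Fin n →₀ ℕ) : Fin n →₀ ℕ :=
  Finsupp.equivFunOnFinite.symm fun i => if a i ≠ 0 then a i + b i else 0

end NGradedModule

/-! Everything follows from one description of the slide: its component of degree `d` is `M_{d-b}`,
with truncated subtraction, and its multiplications are those of `M`. Indeed all components of `M`
are finite-dimensional, so dualizing twice gives back components of `M`; the one in degree `d` is
`M_{(d-b) ∧ c}`, which is `M_{d-b}` because `M` is positively `c`-determined. The structure
`Pullback` records this (`slidePullback`), and after that only the map of degrees `d ↦ d - b`
matters. It has the section `d ↦ d + b`, so `M` is in turn a pullback of its slide.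

Betti numbers: removing a squarefree vector supported in `supp a` commutes with sliding, so the
Koszul complexes of `M` in degree `a` and of the slide in degree `a ◁ b` are isomorphic
(`torPieceEquiv`). A degree not of the form `a ◁ b` has a coordinate with `0 < d_i ≤ b_i`; there
`x_i` acts as an isomorphism and the Koszul complex is exact. As `a` and `a ◁ b` have equal
supports, `sreg` agrees too.

Dimension: it is the largest size of a set `Z` of variables such that some homogeneous element is
killed by no monomial in `Z` (`dim_eq_iSup`), a condition visible through the pullback. Depth:
regular sequences of length `t` exist exactly when Koszul homology vanishes above degree `n - t`
(`exists_isRegular_iff_koszulExact`), which is decided degree by degree.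

`sdepth` and `shreg`: a decomposition is a homogeneous basis split into blocks of degrees, and it
pulls back along both `d ↦ d - b` and `d ↦ d + b`. Preimages of blocks are blocks or empty;
preimages of cones are finite disjoint unions of cones with the same free variables. Each direction
yields one inequality.

Existence of `c`: multiplication by `x_i` is surjective beyond the generator degrees, and its
kernels stabilize since `M` is Noetherian. -/

namespace NGradedModule

/-! ### Homogeneous projections, finite-dimensional components, existence of a determining degree.
-/

section Grading

variable {k : Type*} [Field k] {n : ℕ} (M : NGradedModule k n)

theorem bijective_coeLinearMap : Function.Bijective (DirectSum.coeLinearMap M.piece) :=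
  M.isInternal

/-- The projection of a graded module onto its component of degree `d`. -/
noncomputable def proj (d : Fin n →₀ ℕ) : M →ₗ[k] M :=
  (M.piece d).subtype ∘ₗ DirectSum.component k _ (fun e => M.piece e) d ∘ₗ
    (LinearEquiv.ofBijective _ M.bijective_coeLinearMap).symm.toLinearMap

theorem proj_mem (d : Fin n →₀ ℕ) (m : M) : M.proj d m ∈ M.piece d :=
  Subtype.mem _

theorem ofBijective_symm_of_mem {d : Fin n →₀ ℕ} {m : M} (hm : m ∈ M.piece d) :
    (LinearEquiv.ofBijective _ M.bijective_coeLinearMap).symm m =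
      DirectSum.lof k _ (fun e => M.piece e) d ⟨m, hm⟩ := by
  rw [LinearEquiv.symm_apply_eq, LinearEquiv.ofBijective_apply, DirectSum.coeLinearMap_lof]

theorem proj_of_mem {d : Fin n →₀ ℕ} {m : M} (hm : m ∈ M.piece d) : M.proj d m = m := by
  simp [proj, ofBijective_symm_of_mem M hm, DirectSum.component.lof_self]

theorem proj_of_mem_ne {d e : Fin n →₀ ℕ} {m : M} (hm : m ∈ M.piece e) (h : e ≠ d) :
    M.proj d m = 0 := by
  simp [proj, ofBijective_symm_of_mem M hm, DirectSum.component.of, h]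

@[elab_as_elim]
theorem homogeneous_induction {P : M → Prop} (m : M) (zero : P 0)
    (homogeneous : ∀ d, ∀ m ∈ M.piece d, P m) (add : ∀ x y, P x → P y → P (x + y)) : P m := by
  obtain ⟨x, rfl⟩ := M.isInternal.2 m
  induction x using DirectSum.induction_on with
  | zero => simpa using zero
  | of d x => simpa using homogeneous d x x.2
  | add x y hx hy => rw [map_add]; exact add _ _ hx hy

theorem exists_sum_proj (m : M) :
    ∃ s : Finset (Fin n →₀ ℕ), ∀ t, s ⊆ t → m = ∑ d ∈ t, M.proj d m := by
  classical
  induction m using M.homogeneous_induction with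
  | zero => exact ⟨∅, by simp⟩
  | homogeneous d m hm =>
    refine ⟨{d}, fun t ht => ?_⟩
    rw [Finset.sum_eq_single d (fun e _ he => M.proj_of_mem_ne hm he.symm)
      (fun h => absurd (ht (by simp)) h), M.proj_of_mem hm]
  | add x y hx hy =>
    obtain ⟨s, hs⟩ := hx
    obtain ⟨t, ht⟩ := hy
    refine ⟨s ∪ t, fun u hu => ?_⟩
    simp only [map_add, Finset.sum_add_distrib]
    rw [← hs u (Finset.union_subset_left hu), ← ht u (Finset.union_subset_right hu)]

theorem eq_zero_of_proj {m : M} (h : ∀ d, M.proj d m = 0) : m = 0 := by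
  obtain ⟨s, hs⟩ := M.exists_sum_proj m
  rw [hs s subset_rfl]
  simp [h]

theorem proj_monomial_smul_add (d e : Fin n →₀ ℕ) (m : M) :
    M.proj (d + e) (MvPolynomial.monomial d (1 : k) • m) =
      MvPolynomial.monomial d (1 : k) • M.proj e m := by
  induction m using M.homogeneous_induction with
  | zero => simp
  | homogeneous f m hm =>
    by_cases h : f = e
    · subst h
      rw [M.proj_of_mem hm, M.proj_of_mem (M.monomial_smul_mem d f m hm)]
    · rw [M.proj_of_mem_ne hm h, M.proj_of_mem_ne (M.monomial_smul_mem d f m hm), smul_zero]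
      simpa using h
  | add x y hx hy => simp [smul_add, hx, hy]

theorem proj_monomial_smul {d e : Fin n →₀ ℕ} (h : d ≤ e) (m : M) :
    M.proj e (MvPolynomial.monomial d (1 : k) • m) =
      MvPolynomial.monomial d (1 : k) • M.proj (e - d) m := by
  rw [← proj_monomial_smul_add, add_tsub_cancel_of_le h]

theorem proj_monomial_smul_of_not_le {d e : Fin n →₀ ℕ} (h : ¬ d ≤ e) (m : M) :
    M.proj e (MvPolynomial.monomial d (1 : k) • m) = 0 := by
  induction m using M.homogeneous_induction with
  | zero => simp
  | homogeneous f m hm =>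
    refine M.proj_of_mem_ne (M.monomial_smul_mem d f m hm) ?_
    rintro rfl
    exact h le_self_add
  | add x y hx hy => simp [smul_add, hx, hy]

theorem monomial_smul_monomial_smul (d e : Fin n →₀ ℕ) (m : M) :
    MvPolynomial.monomial d (1 : k) • MvPolynomial.monomial e (1 : k) • m =
      MvPolynomial.monomial (d + e) (1 : k) • m := by
  rw [← mul_smul, MvPolynomial.monomial_mul, one_mul]

theorem monomial_zero_smul (m : M) : MvPolynomial.monomial (0 : Fin n →₀ ℕ) (1 : k) • m = m := by
  rw [← MvPolynomial.one_def, one_smul]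

theorem coe_mulMap {p q : Fin n →₀ ℕ} (h : p ≤ q) (m : M.piece p) :
    (M.mulMap h m : M) = MvPolynomial.monomial (q - p) (1 : k) • (m : M) := rfl

/-- Reduction of polynomial multiples to monomial multiples. -/
theorem smul_induction {p : M → Prop} (f : MvPolynomial (Fin n) k) (m : M)
    (add : ∀ x y, p x → p y → p (x + y))
    (monomial : ∀ (r : k) (d : Fin n →₀ ℕ), p (r • (MvPolynomial.monomial d (1 : k) : MvPolynomial (Fin n) k) • m)) : p (f • m) := by
  induction f using MvPolynomial.monomial_add_induction_on with
  | C a =>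
    have := monomial a 0
    rwa [monomial_zero_smul, ← algebraMap_smul (MvPolynomial (Fin n) k)] at this
  | monomial_add a b f ha hb ih =>
    rw [add_smul]
    refine add _ _ ?_ ih
    have := monomial b a
    rwa [← smul_assoc, MvPolynomial.smul_monomial, smul_eq_mul, mul_one] at this

/-- The homogeneous parts of finitely many generators generate. Degrees are stored with the
elements, since the zero element does not determine its degree. -/
theorem exists_homogeneous_generators [Module.Finite (MvPolynomial (Fin n) k) M] :
    ∃ T : Finset ((Fin n →₀ ℕ) × M), (∀ p ∈ T, p.2 ∈ M.piece p.1) ∧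
      Submodule.span (MvPolynomial (Fin n) k) (Prod.snd '' (T : Set ((Fin n →₀ ℕ) × M))) = ⊤ := by
  classical
  obtain ⟨G, hG⟩ := Module.Finite.fg_top (R := MvPolynomial (Fin n) k) (M := M)
  choose s hs using M.exists_sum_proj
  refine ⟨G.biUnion fun g => (s g).image fun d => (d, M.proj d g), ?_, ?_⟩
  · intro p hp
    simp only [Finset.mem_biUnion, Finset.mem_image] at hp
    obtain ⟨g, -, d, -, rfl⟩ := hp
    exact M.proj_mem d g
  · rw [eq_top_iff, ← hG, Submodule.span_le]
    intro g hg
    rw [SetLike.mem_coe, hs g (s g) subset_rfl]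
    refine Submodule.sum_mem _ fun d hd => Submodule.subset_span ⟨(d, M.proj d g), ?_, rfl⟩
    simp only [Finset.coe_biUnion, Set.mem_iUnion, Finset.coe_image]
    exact ⟨g, hg, d, hd, rfl⟩

theorem piece_le_span {T : Set ((Fin n →₀ ℕ) × M)} (hT : ∀ p ∈ T, p.2 ∈ M.piece p.1)
    (hspan : Submodule.span (MvPolynomial (Fin n) k) (Prod.snd '' T) = ⊤) (d : Fin n →₀ ℕ) :
    M.piece d ≤ Submodule.span k
      ((fun p : (Fin n →₀ ℕ) × M => MvPolynomial.monomial (d - p.1) (1 : k) • p.2) ''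
        {p | p ∈ T ∧ p.1 ≤ d}) := by
  -- Span induction leaves `M_d`, so the claim is made for the projections of an arbitrary element
  -- to all degrees at once.
  suffices H : ∀ (m : M) (d : Fin n →₀ ℕ), M.proj d m ∈ Submodule.span k
      ((fun p : (Fin n →₀ ℕ) × M => MvPolynomial.monomial (d - p.1) (1 : k) • p.2) ''
        {p | p ∈ T ∧ p.1 ≤ d}) by
    intro m hm
    simpa [M.proj_of_mem hm] using H m d
  intro m
  have hm : m ∈ Submodule.span (MvPolynomial (Fin n) k) (Prod.snd '' T) := hspan ▸ trivial
  induction hm using Submodule.span_induction with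
  | mem m hm =>
    obtain ⟨p, hp, rfl⟩ := hm
    intro d
    by_cases h : p.1 = d
    · subst h
      rw [M.proj_of_mem (hT p hp)]
      exact Submodule.subset_span ⟨p, ⟨hp, le_rfl⟩, by simp⟩
    · rw [M.proj_of_mem_ne (hT p hp) h]
      exact Submodule.zero_mem _
  | zero => intro d; simp
  | add x y _ _ hx hy => intro d; rw [map_add]; exact Submodule.add_mem _ (hx d) (hy d)
  | smul f x _ hx =>
    refine M.smul_induction (p := fun m => ∀ d, M.proj d m ∈ Submodule.span k
      ((fun p : (Fin n →₀ ℕ) × M => MvPolynomial.monomial (d - p.1) (1 : k) • p.2) ''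
        {p | p ∈ T ∧ p.1 ≤ d})) f x ?_ ?_
    · intro x y hx hy d
      rw [map_add]
      exact Submodule.add_mem _ (hx d) (hy d)
    · intro r e d
      rw [map_smul]
      refine Submodule.smul_mem _ _ ?_
      by_cases h : e ≤ d
      · rw [M.proj_monomial_smul h]
        have := Submodule.mem_map_of_mem
          (f := (LinearMap.lsmul (MvPolynomial (Fin n) k) M
            (MvPolynomial.monomial e (1 : k))).restrictScalars k) (hx (d - e))
        refine (Submodule.map_span_le _ _ _).2 ?_ this
        rintro _ ⟨p, ⟨hp, hpd⟩, rfl⟩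
        refine Submodule.subset_span ⟨p, ⟨hp, hpd.trans tsub_le_self⟩, ?_⟩
        simp only [LinearMap.coe_restrictScalars, LinearMap.lsmul_apply]
        rw [monomial_smul_monomial_smul, ← add_tsub_assoc_of_le hpd, add_tsub_cancel_of_le h]
      · rw [M.proj_monomial_smul_of_not_le h]
        exact Submodule.zero_mem _

theorem finite_piece [Module.Finite (MvPolynomial (Fin n) k) M] (d : Fin n →₀ ℕ) :
    Module.Finite k (M.piece d) := by
  obtain ⟨T, hT, hspan⟩ := M.exists_homogeneous_generators
  have hfin : ({p | p ∈ (T : Set ((Fin n →₀ ℕ) × M)) ∧ p.1 ≤ d}).Finite :=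
    T.finite_toSet.subset fun p hp => hp.1
  have := FiniteDimensional.span_of_finite k (hfin.image
    fun p : (Fin n →₀ ℕ) × M => MvPolynomial.monomial (d - p.1) (1 : k) • p.2)
  exact Submodule.finiteDimensional_of_le (M.piece_le_span hT hspan d)

/-- If `g` bounds all generator degrees and `g_i ≤ d_i`, every generator contributing to degree `d +
e_i` already contributes to degree `d`, so `x_i` is surjective there. For injectivity, the ascending
chain of kernels of `x_i^N` stabilizes at some `N_i`. -/
theorem exists_isPosDetermined [hM : Module.Finite (MvPolynomial (Fin n) k) M] :
    ∃ c : Fin n →₀ ℕ, M.IsPosDetermined c := by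
  classical
  obtain ⟨T, hT, hspan⟩ := M.exists_homogeneous_generators
  obtain ⟨g, hg⟩ : ∃ g : Fin n →₀ ℕ, ∀ p ∈ T, p.1 ≤ g :=
    ⟨T.sup Prod.fst, fun p hp => Finset.le_sup (f := Prod.fst) hp⟩
  have surj : ∀ (d : Fin n →₀ ℕ) (i : Fin n), g i ≤ d i → ∀ m ∈ M.piece (d + Finsupp.single i 1),
      ∃ m' ∈ M.piece d, (MvPolynomial.X i : MvPolynomial (Fin n) k) • m' = m := by
    intro d i hd m hm
    have hle := M.piece_le_span hT hspan _ hm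
    suffices H : Submodule.span k
        ((fun p : (Fin n →₀ ℕ) × M =>
          MvPolynomial.monomial (d + Finsupp.single i 1 - p.1) (1 : k) • p.2) ''
        {p | p ∈ (T : Set ((Fin n →₀ ℕ) × M)) ∧ p.1 ≤ d + Finsupp.single i 1}) ≤
        (M.piece d).map ((LinearMap.lsmul (MvPolynomial (Fin n) k) M
            (MvPolynomial.X i)).restrictScalars k) from H hle
    rw [Submodule.span_le]
    rintro _ ⟨p, ⟨hp, hpd⟩, rfl⟩
    have hpd' : p.1 ≤ d := by
      intro j
      by_cases hj : j = i
      · subst hj; exact (hg p hp j).trans hd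
      · simpa [Finsupp.single_apply, Ne.symm hj] using hpd j
    refine ⟨MvPolynomial.monomial (d - p.1) (1 : k) • p.2, ?_, ?_⟩
    · have := M.monomial_smul_mem (d - p.1) p.1 _ (hT p hp)
      rwa [tsub_add_cancel_of_le hpd'] at this
    · simp only [LinearMap.coe_restrictScalars, LinearMap.lsmul_apply]
      rw [MvPolynomial.X, monomial_smul_monomial_smul, add_comm, tsub_add_eq_add_tsub hpd']
  have stab : ∀ i : Fin n, ∃ N : ℕ, ∀ m : M,
      (MvPolynomial.X i : MvPolynomial (Fin n) k) ^ (N + 1) • m = 0 →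
      (MvPolynomial.X i : MvPolynomial (Fin n) k) ^ N • m = 0 := by
    intro i
    obtain ⟨N, hN⟩ := monotone_stabilizes_iff_noetherian.2
      (isNoetherian_of_isNoetherianRing_of_finite (MvPolynomial (Fin n) k) M)
      ⟨fun N => LinearMap.ker (LinearMap.lsmul (MvPolynomial (Fin n) k) M
        (MvPolynomial.X i ^ N)), monotone_nat_of_le_succ fun N m hm => by
          simp only [LinearMap.mem_ker, LinearMap.lsmul_apply] at hm ⊢
          rw [pow_succ', mul_smul, hm, smul_zero]⟩
    refine ⟨N, fun m hm => ?_⟩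
    have h := hN (N + 1) (Nat.le_succ N)
    exact (SetLike.ext_iff.1 h m).2 hm
  choose N hN using stab
  have surjPow : ∀ (r : ℕ) (d : Fin n →₀ ℕ) (i : Fin n), g i ≤ d i →
      ∀ m ∈ M.piece (d + Finsupp.single i r),
      ∃ m' ∈ M.piece d, (MvPolynomial.X i : MvPolynomial (Fin n) k) ^ r • m' = m := by
    intro r
    induction r with
    | zero => intro d i _ m hm; exact ⟨m, by simpa using hm, by simp⟩
    | succ r ih =>
      intro d i hd m hm
      rw [Finsupp.single_add, ← add_assoc] at hm
      obtain ⟨m₁, hm₁, rfl⟩ := surj (d + Finsupp.single i r) i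
        (hd.trans (by simp)) m hm
      obtain ⟨m₂, hm₂, rfl⟩ := ih d i hd m₁ hm₁
      exact ⟨m₂, hm₂, by rw [pow_succ', mul_smul]⟩
  -- The summand `N_i` leaves room to write a difference `x - y` killed by `x_i` as `x_i^{N_i} m`.
  -- Then `x_i^{N_i+1} m = 0`, and stability of the kernels gives `x - y = 0`.
  refine ⟨g + Finsupp.equivFunOnFinite.symm N, hM, fun d i hd => ⟨?_, ?_, ?_⟩⟩
  · intro m hm
    rw [add_comm]
    exact M.monomial_smul_mem _ _ m hm
  · intro x hx y hy hxy
    rw [← sub_eq_zero] at hxy ⊢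
    simp only [← smul_sub] at hxy
    have hdN : Finsupp.single i (N i) ≤ d := by
      rw [Finsupp.single_le_iff]
      exact le_trans (by simp) hd
    have hmem : x - y ∈ M.piece (d - Finsupp.single i (N i) + Finsupp.single i (N i)) := by
      rw [tsub_add_cancel_of_le hdN]
      exact Submodule.sub_mem _ hx hy
    obtain ⟨m, -, hm⟩ := surjPow (N i) _ i (by simp at hd ⊢; omega) _ hmem
    rw [← hm] at hxy ⊢
    exact hN i m (by rwa [pow_succ', mul_smul])
  · intro m hm
    exact surj d i (le_trans (by simp) hd) m hm

end Grading

end NGradedModule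

/-! ### Pullbacks of graded modules along a monotone map of degrees. -/

namespace NGradedModule

universe u v w

variable {k : Type u} [Field k] {n : ℕ}

/-- Data identifying `N_d` with `M_{φ d}` for all `d`, compatibly with multiplication by
monomials. The maps are extended by zero to linear maps defined on all of `M`. -/
structure Pullback (M : NGradedModule.{u, v} k n) (N : NGradedModule.{u, w} k n)
    (φ : (Fin n →₀ ℕ) → (Fin n →₀ ℕ)) where
  mono : Monotone φ
  toFun : (Fin n →₀ ℕ) → M →ₗ[k] N
  bijOn : ∀ d, Set.BijOn (toFun d) (M.piece (φ d)) (N.piece d)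
  map_monomial : ∀ {p q : Fin n →₀ ℕ}, p ≤ q → ∀ m ∈ M.piece (φ p),
    toFun q (MvPolynomial.monomial (φ q - φ p) (1 : k) • m) =
      MvPolynomial.monomial (q - p) (1 : k) • toFun p m

namespace Pullback

variable {M : NGradedModule.{u, v} k n} {N : NGradedModule.{u, w} k n}
  {φ : (Fin n →₀ ℕ) → (Fin n →₀ ℕ)}

/-- A pullback from linear equivalences of components. -/
noncomputable def ofEquiv (hφ : Monotone φ) (e : ∀ d, N.piece d ≃ₗ[k] M.piece (φ d))
    (he : ∀ {p q : Fin n →₀ ℕ} (h : p ≤ q) (y : N.piece p),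
      e q (N.mulMap h y) = M.mulMap (hφ h) (e p y)) : Pullback M N φ where
  mono := hφ
  toFun d := (N.piece d).subtype ∘ₗ (e d).symm.toLinearMap ∘ₗ
    (M.proj (φ d)).codRestrict (M.piece (φ d)) (M.proj_mem (φ d))
  bijOn d := by
    have key : ∀ m (hm : m ∈ M.piece (φ d)),
        (M.proj (φ d)).codRestrict (M.piece (φ d)) (M.proj_mem (φ d)) m = ⟨m, hm⟩ :=
      fun m hm => Subtype.ext (M.proj_of_mem hm)
    refine ⟨fun m _ => Subtype.mem _, fun x hx y hy hxy => ?_, fun y hy => ?_⟩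
    · have hxy' := (e d).symm.injective (Subtype.ext hxy)
      rw [key x hx, key y hy] at hxy'
      exact congrArg Subtype.val hxy'
    · refine ⟨e d ⟨y, hy⟩, Subtype.mem _, ?_⟩
      simp only [LinearMap.comp_apply]
      rw [key _ (Subtype.mem _)]
      simp
  map_monomial {p q} h m hm := by
    have key : ∀ d m (hm : m ∈ M.piece (φ d)),
        (M.proj (φ d)).codRestrict (M.piece (φ d)) (M.proj_mem (φ d)) m = ⟨m, hm⟩ :=
      fun d m hm => Subtype.ext (M.proj_of_mem hm)
    have hmem := (M.mulMap (hφ h) ⟨m, hm⟩).2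
    rw [coe_mulMap] at hmem
    simp only [LinearMap.comp_apply]
    rw [key p m hm, key q _ hmem]
    have := he h ((e p).symm ⟨m, hm⟩)
    rw [LinearEquiv.apply_symm_apply, ← LinearEquiv.eq_symm_apply] at this
    exact (congrArg Subtype.val this).symm

/-- The identification `M_{φ d} ≃ N_d` underlying a pullback. -/
noncomputable def equiv (P : Pullback M N φ) (d : Fin n →₀ ℕ) :
    M.piece (φ d) ≃ₗ[k] N.piece d :=
  LinearEquiv.ofBijective ((P.toFun d).restrict (p := M.piece (φ d)) (q := N.piece d)
      (P.bijOn d).mapsTo)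
    ⟨fun x y h => Subtype.ext ((P.bijOn d).injOn x.2 y.2 (congrArg Subtype.val h)),
      fun y => by
        obtain ⟨x, hx, hxy⟩ := (P.bijOn d).surjOn y.2
        exact ⟨⟨x, hx⟩, Subtype.ext hxy⟩⟩

theorem coe_equiv (P : Pullback M N φ) (d : Fin n →₀ ℕ) (m : M.piece (φ d)) :
    (P.equiv d m : N) = P.toFun d m := rfl

theorem equiv_mulMap (P : Pullback M N φ) {p q : Fin n →₀ ℕ} (h : p ≤ q)
    (m : M.piece (φ p)) : P.equiv q (M.mulMap (P.mono h) m) = N.mulMap h (P.equiv p m) :=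
  Subtype.ext (P.map_monomial h m m.2)

theorem mulMap_eqRec (M : NGradedModule.{u, v} k n) {p p' q q' : Fin n →₀ ℕ} (hp : p = p')
    (hq : q = q') (h : p ≤ q) (h' : p' ≤ q') (x : M.piece p) :
    LinearEquiv.ofEq _ _ (congrArg M.piece hq) (M.mulMap h x) =
      M.mulMap h' (LinearEquiv.ofEq _ _ (congrArg M.piece hp) x) := by
  subst hp hq
  rfl

/-- If `ψ` is a section of `φ`, then the components of `M` are the components of `N` along
`ψ`. -/
noncomputable def ofSection (P : Pullback M N φ) {ψ : (Fin n →₀ ℕ) → (Fin n →₀ ℕ)}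
    (hψ : Monotone ψ) (h : ∀ d, φ (ψ d) = d) : Pullback N M ψ :=
  ofEquiv hψ (fun d => LinearEquiv.ofEq _ _ (congrArg M.piece (h d).symm) ≪≫ₗ P.equiv (ψ d))
    fun {p q} hpq y => by
      simp only [LinearEquiv.trans_apply]
      rw [mulMap_eqRec M (h p).symm (h q).symm hpq (P.mono (hψ hpq)), P.equiv_mulMap]

theorem toFun_mem (P : Pullback M N φ) {d : Fin n →₀ ℕ} {m : M} (hm : m ∈ M.piece (φ d)) :
    P.toFun d m ∈ N.piece d := (P.bijOn d).mapsTo hm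

theorem toFun_eq_zero_iff (P : Pullback M N φ) {d : Fin n →₀ ℕ} {m : M}
    (hm : m ∈ M.piece (φ d)) : P.toFun d m = 0 ↔ m = 0 := by
  constructor
  · intro h
    exact (P.bijOn d).injOn hm (Submodule.zero_mem _) (by rw [h, map_zero])
  · rintro rfl
    exact map_zero _

theorem exists_toFun_eq (P : Pullback M N φ) {d : Fin n →₀ ℕ} {y : N} (hy : y ∈ N.piece d) :
    ∃ m ∈ M.piece (φ d), P.toFun d m = y := (P.bijOn d).surjOn hy

end Pullback

/-! ### The slide as a pullback along truncated subtraction. -/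

section Slide

variable (M : NGradedModule.{u, v} k n)

/-- The multiplication factors into unit steps, each in a direction `i` where the current degree is
at least `c_i`; the induction is on the number of steps. -/
theorem mulMap_bijective {c : Fin n →₀ ℕ} (hM : M.IsPosDetermined c) {p q : Fin n →₀ ℕ}
    (h : p ≤ q) (hpq : ∀ i, p i < c i → q i = p i) : Function.Bijective (M.mulMap h) := by
  induction hr : (q - p).degree generalizing p with
  | zero =>
    obtain rfl : p = q := le_antisymm h (tsub_eq_zero_iff_le.1 (Finsupp.degree_eq_zero_iff _ |>.1 hr))
    rw [mulMap_refl]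
    exact Function.bijective_id
  | succ r ih =>
    obtain ⟨i, hi⟩ : ∃ i, p i < q i := by
      by_contra! hcon
      rw [tsub_eq_zero_iff_le.2 (show q ≤ p from hcon), map_zero] at hr
      omega
    have hci : c i ≤ p i := by
      by_contra! hlt
      exact hi.ne' (hpq i hlt)
    have hle : p + Finsupp.single i 1 ≤ q := by
      intro j
      by_cases hj : i = j
      · subst hj; simpa using hi
      · simpa [Finsupp.single_apply, hj] using h j
    have hsub : q - p = q - (p + Finsupp.single i 1) + Finsupp.single i 1 := by
      rw [← tsub_tsub, tsub_add_cancel_of_le]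
      exact (le_tsub_iff_left h).2 hle
    rw [hsub, map_add, Finsupp.degree_single] at hr
    rw [← M.mulMap_comp le_self_add hle, LinearMap.coe_comp]
    refine (ih hle (fun j hj => ?_) (by omega)).comp ?_
    · by_cases hij : i = j
      · subst hij; simp at hj; omega
      · simp only [Finsupp.add_apply, Finsupp.single_apply, hij, if_false, add_zero] at hj ⊢
        exact hpq j hj
    · have hb := hM.2 p i hci
      have hX : ∀ x : M.piece p, (M.mulMap (le_self_add : p ≤ p + Finsupp.single i 1) x : M) =
          (MvPolynomial.X i : MvPolynomial (Fin n) k) • (x : M) := fun x => by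
        rw [coe_mulMap, add_tsub_cancel_left]; rfl
      refine ⟨fun x y hxy => Subtype.ext (hb.injOn x.2 y.2 ?_), fun y => ?_⟩
      · have := congrArg Subtype.val hxy
        rwa [hX, hX] at this
      · obtain ⟨x, hx, hxy⟩ := hb.surjOn y.2
        exact ⟨⟨x, hx⟩, Subtype.ext ((hX _).trans hxy)⟩

/-- The components of the Alexander dual are the duals of the components. -/
noncomputable def alexPieceEquiv (c d : Fin n →₀ ℕ) :
    (M.alexDual c).piece d ≃ₗ[k] Module.Dual k (M.piece (c - d)) :=
  (LinearEquiv.ofInjective (DirectSum.lof k _ (M.AlexComp c) d)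
    (DirectSum.of_injective (β := M.AlexComp c) d)).symm

theorem coe_alexPieceEquiv_symm (c d : Fin n →₀ ℕ) (x : Module.Dual k (M.piece (c - d))) :
    ((M.alexPieceEquiv c d).symm x : M.alexDual c) = DirectSum.lof k _ (M.AlexComp c) d x :=
  rfl

theorem alexPieceEquiv_symm_dualMap (c : Fin n →₀ ℕ) {p q : Fin n →₀ ℕ} (h : p ≤ q)
    (x : Module.Dual k (M.piece (c - p))) :
    (M.alexDual c).mulMap h ((M.alexPieceEquiv c p).symm x) =
      (M.alexPieceEquiv c q).symm ((M.mulMap (tsub_le_tsub_left h c)).dualMap x) := by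
  refine Subtype.ext ?_
  rw [coe_mulMap, coe_alexPieceEquiv_symm, coe_alexPieceEquiv_symm]
  change M.alexAction c (MvPolynomial.monomial (q - p) 1) _ = _
  rw [alexAction_monomial]
  refine (M.alexMul_lof c (q - p) p x).trans ?_
  exact M.lof_alexCompMap_congr c (tsub_add_cancel_of_le h) _ h x

variable [Module.Finite (MvPolynomial (Fin n) k) M]

/-- The components of a double Alexander dual. -/
noncomputable def alexAlexPieceEquiv (c c' d : Fin n →₀ ℕ) :
    ((M.alexDual c).alexDual c').piece d ≃ₗ[k] M.piece (c - (c' - d)) :=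
  haveI := M.finite_piece (c - (c' - d))
  (M.alexDual c).alexPieceEquiv c' d ≪≫ₗ (M.alexPieceEquiv c (c' - d)).symm.dualMap ≪≫ₗ
    (Module.evalEquiv k (M.piece (c - (c' - d)))).symm

/-- Evaluation into the double dual is natural, so the transpose of the transpose of a
multiplication is that multiplication. -/
theorem alexAlexPieceEquiv_mulMap (c c' : Fin n →₀ ℕ) {p q : Fin n →₀ ℕ} (h : p ≤ q)
    (y : ((M.alexDual c).alexDual c').piece p) :
    M.alexAlexPieceEquiv c c' q (((M.alexDual c).alexDual c').mulMap h y) =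
      M.mulMap (tsub_le_tsub_left (tsub_le_tsub_left h c') c)
        (M.alexAlexPieceEquiv c c' p y) := by
  have := M.finite_piece (c - (c' - p))
  have := M.finite_piece (c - (c' - q))
  obtain ⟨x, rfl⟩ := (M.alexAlexPieceEquiv c c' p).symm.surjective y
  rw [LinearEquiv.apply_symm_apply, ← LinearEquiv.eq_symm_apply]
  simp only [alexAlexPieceEquiv, LinearEquiv.trans_symm, LinearEquiv.trans_apply,
    LinearEquiv.symm_symm]
  rw [alexPieceEquiv_symm_dualMap]
  congr 1
  refine LinearMap.ext fun z => ?_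
  obtain ⟨z, rfl⟩ := (M.alexPieceEquiv c (c' - q)).symm.surjective z
  simp only [LinearMap.dualMap_apply]
  erw [alexPieceEquiv_symm_dualMap]
  simp [LinearEquiv.dualMap_symm]

/-- The components of the slide `M^{◁ b}` are `M_{d - b}`, with truncated subtraction. -/
noncomputable def slidePullback {c : Fin n →₀ ℕ} (hM : M.IsPosDetermined c) (b : Fin n →₀ ℕ) :
    Pullback M (M.slide c b) (fun d => d - b) :=
  show Pullback M ((M.alexDual c).alexDual (b + c)) (fun d => d - b) from
  -- Coordinatewise, `c - (b + c - d)` is the minimum of `d - b` and `c`. It differs from `d - b`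
  -- only where it equals `c_i`, which is where `M` no longer changes.
  have hle : ∀ d, c - (b + c - d) ≤ d - b := fun d i => by simp; omega
  Pullback.ofEquiv (fun _ _ h => tsub_le_tsub_right h b)
    (fun d => M.alexAlexPieceEquiv c (b + c) d ≪≫ₗ
      LinearEquiv.ofBijective (M.mulMap (hle d))
        (M.mulMap_bijective hM (hle d) fun i hi => by simp at hi ⊢; omega))
    fun {p q} h y => by
      simp only [LinearEquiv.trans_apply, LinearEquiv.ofBijective_apply]
      erw [alexAlexPieceEquiv_mulMap]
      rw [← LinearMap.comp_apply, ← LinearMap.comp_apply, mulMap_comp, mulMap_comp]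

end Slide

end NGradedModule

/-! ### Koszul homology of pullbacks: graded Betti numbers and support regularity. -/

namespace NGradedModule

universe u v w

variable {k : Type u} [Field k] {n : ℕ}

section Chains

variable (M : NGradedModule.{u, v} k n)

theorem indicator_apply (F : Finset (Fin n)) (i : Fin n) :
    indicator F i = if i ∈ F then 1 else 0 := by
  simp [indicator, Finsupp.finsetSum_apply, Finsupp.single_apply]

theorem indicator_le_iff {F : Finset (Fin n)} {a : Fin n →₀ ℕ} :
    indicator F ≤ a ↔ ∀ i ∈ F, a i ≠ 0 := by
  constructor
  · intro h i hi
    have := h i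
    rw [indicator_apply, if_pos hi] at this
    omega
  · intro h i
    rw [indicator_apply]
    split_ifs with hi
    · have := h i hi
      omega
    · exact Nat.zero_le _

theorem indicator_insert {G : Finset (Fin n)} {j : Fin n} (hj : j ∉ G) :
    indicator (insert j G) = indicator G + Finsupp.single j 1 := by
  rw [indicator, Finset.sum_insert hj, add_comm]; rfl

theorem mem_koszulChains {i : ℕ} {b : Fin n →₀ ℕ} {u : Finset (Fin n) → M} :
    u ∈ M.koszulChains i b ↔ ∀ F,
      (F.card = i ∧ indicator F ≤ b → u F ∈ M.piece (b - indicator F)) ∧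
      (¬ (F.card = i ∧ indicator F ≤ b) → u F = 0) := by
  simp only [koszulChains, Submodule.mem_pi, Set.mem_univ, true_imp_iff]
  refine forall_congr' fun F => ?_
  by_cases h : F.card = i ∧ indicator F ≤ b
  · simp [h]
  · simp [h]

theorem koszulD_apply (u : Finset (Fin n) → M) (G : Finset (Fin n)) :
    M.koszulD u G = ∑ j ∈ Gᶜ, (-1 : k) ^ (G.filter (· < j)).card •
      ((MvPolynomial.X j : MvPolynomial (Fin n) k) • u (insert j G)) := rfl

theorem tsub_indicator_insert_add {G : Finset (Fin n)} {j : Fin n} (hj : j ∉ G)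
    {a : Fin n →₀ ℕ} (h : indicator (insert j G) ≤ a) :
    a - indicator (insert j G) + Finsupp.single j 1 = a - indicator G := by
  rw [indicator_insert hj] at h ⊢
  rw [← tsub_tsub, tsub_add_cancel_of_le]
  exact (le_tsub_iff_left (le_self_add.trans h)).2 h

theorem subsingleton_torPiece_iff (i : ℕ) (b : Fin n →₀ ℕ) :
    Subsingleton (M.TorPiece i b) ↔ M.koszulCycles i b ≤ M.koszulBoundaries i b := by
  rw [Submodule.Quotient.subsingleton_iff, Submodule.comap_subtype_eq_top]

end Chains

namespace Pullback

variable {M : NGradedModule.{u, v} k n} {N : NGradedModule.{u, w} k n}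
  {φ : (Fin n →₀ ℕ) → (Fin n →₀ ℕ)}

/-- The map induced by a pullback on Koszul chains of degree `a`. -/
noncomputable def koszulMap (P : Pullback M N φ) (a : Fin n →₀ ℕ) :
    (Finset (Fin n) → M) →ₗ[k] (Finset (Fin n) → N) :=
  LinearMap.pi fun F => P.toFun (a - indicator F) ∘ₗ LinearMap.proj F

theorem koszulMap_apply (P : Pullback M N φ) (a : Fin n →₀ ℕ) (u : Finset (Fin n) → M)
    (F : Finset (Fin n)) : P.koszulMap a u F = P.toFun (a - indicator F) (u F) := rfl

/-- The degrees `a` of `M` and `a'` of `N` have the same Koszul complexes. -/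
def KoszulCompatible (φ : (Fin n →₀ ℕ) → (Fin n →₀ ℕ)) (a a' : Fin n →₀ ℕ) : Prop :=
  ∀ F, (indicator F ≤ a ↔ indicator F ≤ a') ∧
    (indicator F ≤ a → φ (a' - indicator F) = a - indicator F)

variable {a a' : Fin n →₀ ℕ}

theorem koszulMap_bijOn (P : Pullback M N φ) (h : KoszulCompatible φ a a') (i : ℕ) :
    Set.BijOn (P.koszulMap a') (M.koszulChains i a) (N.koszulChains i a') := by
  refine ⟨fun u hu => ?_, fun u hu v hv huv => ?_, fun v hv => ?_⟩
  · rw [SetLike.mem_coe, mem_koszulChains] at hu ⊢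
    refine fun F => ⟨fun hF => ?_, fun hF => ?_⟩
    · rw [← (h F).1] at hF
      exact P.toFun_mem (by rw [(h F).2 hF.2]; exact (hu F).1 hF)
    · rw [← (h F).1] at hF
      rw [koszulMap_apply, (hu F).2 hF, map_zero]
  · rw [SetLike.mem_coe, mem_koszulChains] at hu hv
    funext F
    by_cases hF : F.card = i ∧ indicator F ≤ a
    · refine (P.bijOn (a' - indicator F)).injOn ?_ ?_ (congrFun huv F)
      · rw [(h F).2 hF.2]; exact (hu F).1 hF
      · rw [(h F).2 hF.2]; exact (hv F).1 hF
    · rw [(hu F).2 hF, (hv F).2 hF]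
  · rw [SetLike.mem_coe, mem_koszulChains] at hv
    have : ∀ F, ∃ m : M, P.toFun (a' - indicator F) m = v F ∧
        (F.card = i ∧ indicator F ≤ a → m ∈ M.piece (a - indicator F)) ∧
        (¬ (F.card = i ∧ indicator F ≤ a) → m = 0) := by
      intro F
      by_cases hF : F.card = i ∧ indicator F ≤ a
      · obtain ⟨m, hm, hmv⟩ := P.exists_toFun_eq ((hv F).1 ⟨hF.1, (h F).1.1 hF.2⟩)
        exact ⟨m, hmv, fun _ => (h F).2 hF.2 ▸ hm, fun h => absurd hF h⟩
      · exact ⟨0, by rw [map_zero, (hv F).2 (by rwa [← (h F).1])], fun h => absurd h hF,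
          fun _ => rfl⟩
    choose u hu hu' using this
    exact ⟨u, M.mem_koszulChains.2 hu', funext hu⟩

/-- The differential uses only multiplications by `x_j` between degrees `a' - indicator (insert j
G)` and `a' - indicator G`; compatibility makes the corresponding degrees of `M` differ by the same
unit vector. -/
theorem koszulD_koszulMap (P : Pullback M N φ) (h : KoszulCompatible φ a a') {i : ℕ}
    {u : Finset (Fin n) → M} (hu : u ∈ M.koszulChains i a) :
    N.koszulD (P.koszulMap a' u) = P.koszulMap a' (M.koszulD u) := by
  rw [mem_koszulChains] at hu
  funext G
  rw [koszulMap_apply, koszulD_apply, koszulD_apply, map_sum]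
  refine Finset.sum_congr rfl fun j hj => ?_
  rw [Finset.mem_compl] at hj
  rw [map_smul, koszulMap_apply]
  congr 1
  by_cases hF : (insert j G).card = i ∧ indicator (insert j G) ≤ a
  · have hF' := (h _).1.1 hF.2
    have hGle : indicator G ≤ indicator (insert j G) := by
      rw [indicator_insert hj]; exact le_self_add
    have hle : a' - indicator (insert j G) ≤ a' - indicator G := tsub_le_tsub_left hGle a'
    have := P.map_monomial hle (u (insert j G)) (by rw [(h _).2 hF.2]; exact (hu _).1 hF)
    rw [(h _).2 hF.2, (h G).2 (hGle.trans hF.2), ← tsub_indicator_insert_add hj hF.2,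
      ← tsub_indicator_insert_add hj hF', add_tsub_cancel_left, add_tsub_cancel_left] at this
    rw [← tsub_indicator_insert_add hj hF']
    exact this.symm
  · rw [(hu _).2 hF]
    simp

theorem koszulMap_bijOn_cycles (P : Pullback M N φ) (h : KoszulCompatible φ a a') (i : ℕ) :
    Set.BijOn (P.koszulMap a') (M.koszulCycles i a) (N.koszulCycles i a') := by
  have hb := P.koszulMap_bijOn h i
  have hD : ∀ u ∈ M.koszulChains i a, (N.koszulD (P.koszulMap a' u) = 0 ↔ M.koszulD u = 0) := by
    intro u hu
    rw [P.koszulD_koszulMap h hu]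
    -- No chain space precedes homological degree zero; there the differential vanishes because it
    -- only reads values on nonempty sets.
    cases i with
    | zero =>
      have h0 : M.koszulD u = 0 := by
        rw [mem_koszulChains] at hu
        funext G
        rw [koszulD_apply]
        refine Finset.sum_eq_zero fun j hj => ?_
        rw [(hu _).2, smul_zero, smul_zero]
        intro hc
        have := Finset.card_pos.2 (Finset.insert_nonempty j G)
        omega
      rw [h0, map_zero]
      simp
    | succ i =>
      have hDu := M.koszulD_mem_chains hu
      constructor
      · intro h0
        exact (P.koszulMap_bijOn h i).injOn hDu (Submodule.zero_mem _) (by rw [h0, map_zero])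
      · intro h0
        rw [h0, map_zero]
  refine ⟨fun u hu => ⟨hb.mapsTo hu.1, (hD u hu.1).2 hu.2⟩,
    hb.injOn.mono fun u hu => hu.1, fun v hv => ?_⟩
  obtain ⟨u, hu, rfl⟩ := hb.surjOn hv.1
  exact ⟨u, ⟨hu, (hD u hu).1 hv.2⟩, rfl⟩

theorem map_koszulBoundaries (P : Pullback M N φ) (h : KoszulCompatible φ a a') (i : ℕ) :
    (M.koszulBoundaries i a).map (P.koszulMap a') = N.koszulBoundaries i a' := by
  ext v
  constructor
  · rintro ⟨_, ⟨u, hu, rfl⟩, rfl⟩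
    exact ⟨P.koszulMap a' u, (P.koszulMap_bijOn h (i + 1)).mapsTo hu, P.koszulD_koszulMap h hu⟩
  · rintro ⟨v, hv, rfl⟩
    obtain ⟨u, hu, rfl⟩ := (P.koszulMap_bijOn h (i + 1)).surjOn hv
    exact ⟨M.koszulD u, ⟨u, hu, rfl⟩, (P.koszulD_koszulMap h hu).symm⟩

/-- Compatible degrees have isomorphic `Tor`. -/
noncomputable def torPieceEquiv (P : Pullback M N φ) (h : KoszulCompatible φ a a') (i : ℕ) :
    M.TorPiece i a ≃ₗ[k] N.TorPiece i a' :=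
  have hb := P.koszulMap_bijOn_cycles h i
  Submodule.Quotient.equiv _ _
    (LinearEquiv.ofBijective ((P.koszulMap a').restrict (p := M.koszulCycles i a)
      (q := N.koszulCycles i a') hb.mapsTo)
      ⟨fun x y hxy => Subtype.ext (hb.injOn x.2 y.2 (congrArg Subtype.val hxy)),
        fun y => by
          obtain ⟨x, hx, hxy⟩ := hb.surjOn y.2
          exact ⟨⟨x, hx⟩, Subtype.ext hxy⟩⟩)
    (by
      ext ⟨v, hv⟩
      constructor
      · rintro ⟨u, hu, huv⟩
        rw [← huv]
        exact P.map_koszulBoundaries h i ▸ Submodule.mem_map_of_mem hu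
      · intro hvB
        rw [Submodule.mem_comap, ← P.map_koszulBoundaries h i] at hvB
        obtain ⟨u, hu, huv⟩ := hvB
        exact ⟨⟨u, M.koszulBoundaries_le_koszulCycles i a hu⟩, hu, Subtype.ext huv⟩)

end Pullback

theorem neg_one_pow_smul_smul {k E : Type*} [CommRing k] [AddCommGroup E] [Module k E] (m : ℕ)
    (x : E) : (-1 : k) ^ m • (-1 : k) ^ m • x = x := by
  rw [smul_smul, ← mul_pow]
  simp

/-- If `x_i` is bijective between the components of degrees `d_i - 1` and `d_i` in direction `i`,
then the Koszul complex of degree `d` is exact. -/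
theorem koszulCycles_le_koszulBoundaries (N : NGradedModule.{u, v} k n) {d : Fin n →₀ ℕ}
    {i : Fin n} (hd : d i ≠ 0)
    (hbij : ∀ e : Fin n →₀ ℕ, e i + 1 = d i →
      Set.BijOn (fun m : N => (MvPolynomial.X i : MvPolynomial (Fin n) k) • m)
        (N.piece e) (N.piece (e + Finsupp.single i 1))) (r : ℕ) :
    N.koszulCycles r d ≤ N.koszulBoundaries r d := by
  rintro u ⟨hu, hDu⟩
  rw [SetLike.mem_coe] at hu
  have hu' := N.mem_koszulChains.1 hu
  have hdi : ∀ F : Finset (Fin n), i ∉ F →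
      (d - indicator (insert i F)) i + 1 = d i := by
    intro F hF
    rw [Finsupp.tsub_apply, indicator_apply, if_pos (Finset.mem_insert_self _ _)]
    omega
  have hle : ∀ F : Finset (Fin n), indicator (insert i F) ≤ d ↔ indicator F ≤ d := by
    intro F
    rw [indicator_le_iff, indicator_le_iff]
    simp [hd]
  -- In degree `d` the complex is the mapping cone of `x_i`, from the components with `i ∈ F` to
  -- those with `i ∉ F`, and `x_i` is bijective here. First divide the components of `u` with `i ∉
  -- F` by `x_i`.
  have : ∀ F : Finset (Fin n), ∃ y : N, i ∉ F →
      (MvPolynomial.X i : MvPolynomial (Fin n) k) • y = u F ∧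
        (F.card = r ∧ indicator F ≤ d → y ∈ N.piece (d - indicator (insert i F))) ∧
        (¬ (F.card = r ∧ indicator F ≤ d) → y = 0) := by
    intro F
    by_cases hF : F.card = r ∧ indicator F ≤ d
    · by_cases hi : i ∈ F
      · exact ⟨0, fun h => absurd hi h⟩
      have hm := (hu' F).1 hF
      rw [← tsub_indicator_insert_add hi ((hle F).2 hF.2)] at hm
      obtain ⟨y, hy, hyu⟩ := (hbij _ (hdi F hi)).surjOn hm
      exact ⟨y, fun _ => ⟨hyu, fun _ => hy, fun h => absurd hF h⟩⟩
    · exact ⟨0, fun _ => ⟨by rw [smul_zero, (hu' F).2 hF], fun h => absurd h hF, fun _ => rfl⟩⟩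
  choose y hy using this
  -- This is `e_i ∧ (u / x_i)`; the sign cancels the one in the differential, so that `Dv` agrees
  -- with `u` on all sets not containing `i`.
  let v : Finset (Fin n) → N := fun G =>
    if i ∈ G then (-1 : k) ^ ((G.erase i).filter (· < i)).card • y (G.erase i) else 0
  have hv : v ∈ N.koszulChains (r + 1) d := by
    rw [mem_koszulChains]
    intro G
    by_cases hi : i ∈ G
    · obtain ⟨-, h1, h2⟩ := hy (G.erase i) (Finset.notMem_erase i G)
      rw [← hle, Finset.insert_erase hi] at h1 h2
      have hcard := Finset.card_erase_add_one hi
      simp only [v, if_pos hi]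
      refine ⟨fun h => Submodule.smul_mem _ _ (h1 ⟨by omega, h.2⟩), fun h => ?_⟩
      rw [h2 (fun h' => h ⟨by omega, h'.2⟩), smul_zero]
    · simp [v, hi]
  have hDv : ∀ G, i ∉ G → N.koszulD v G = u G := by
    intro G hi
    rw [koszulD_apply, Finset.sum_eq_single i]
    · simp only [v, Finset.mem_insert_self, if_true, Finset.erase_insert hi]
      rw [← (hy G hi).1, smul_algebra_smul_comm _ (MvPolynomial.X i : MvPolynomial (Fin n) k), neg_one_pow_smul_smul]
    · intro j _ hj
      simp [v, hi, Ne.symm hj]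
    · intro h
      simp [hi] at h
  refine ⟨v, hv, ?_⟩
  have hw : N.koszulD (u - N.koszulD v) = 0 := by
    rw [map_sub, koszulD_koszulD, sub_zero]; exact hDu
  have hwc := N.mem_koszulChains.1 (Submodule.sub_mem _ hu (N.koszulD_mem_chains hv))
  symm
  rw [← sub_eq_zero]
  funext G
  by_cases hi : i ∈ G
  -- The cycle `u - Dv` lives on sets containing `i`, so its differential at `G ∖ {i}` has the
  -- single term `± x_i (u - Dv)_G`; injectivity of `x_i` finishes.
  · have hG := congrFun hw (G.erase i)
    rw [koszulD_apply, Finset.sum_eq_single i, Finset.insert_erase hi] at hG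
    · have hz := congrArg (fun m => (-1 : k) ^ ((G.erase i).filter (· < i)).card • m) hG
      simp only [neg_one_pow_smul_smul, Pi.zero_apply, smul_zero] at hz
      by_cases hF : G.card = r ∧ indicator G ≤ d
      · have hin := hbij _ (hdi (G.erase i) (Finset.notMem_erase i G))
        rw [Finset.insert_erase hi] at hin
        exact hin.injOn ((hwc G).1 hF) (Submodule.zero_mem _) (by simpa using hz)
      · exact (hwc G).2 hF
    · intro j _ hj
      rw [Pi.sub_apply, hDv, sub_self, smul_zero, smul_zero]
      simp [Ne.symm hj]
    · intro h
      simp at h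
  · rw [Pi.sub_apply, hDv G hi, sub_self, Pi.zero_apply]

section Slide

variable {M : NGradedModule.{u, v} k n} {N : NGradedModule.{u, w} k n} {b : Fin n →₀ ℕ}

theorem slideDeg_apply (a b : Fin n →₀ ℕ) (i : Fin n) :
    slideDeg a b i = if a i ≠ 0 then a i + b i else 0 := rfl

theorem support_slideDeg (a b : Fin n →₀ ℕ) : (slideDeg a b).support = a.support := by
  ext i
  simp only [Finsupp.mem_support_iff, slideDeg_apply]
  split_ifs with h <;> simp [h]

/-- For `i ∈ F` one has `a_i ≥ 1`, so `(a_i + b_i - 1) - b_i = a_i - 1`; where `a_i = 0` both sides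
vanish. -/
theorem koszulCompatible_slideDeg (a b : Fin n →₀ ℕ) :
    Pullback.KoszulCompatible (fun d => d - b) a (slideDeg a b) := by
  refine fun F => ⟨?_, fun h => ?_⟩
  · rw [indicator_le_iff, indicator_le_iff]
    simp only [← Finsupp.mem_support_iff, support_slideDeg]
  · ext i
    rw [indicator_le_iff] at h
    have := h i
    simp only [Finsupp.tsub_apply, indicator_apply, slideDeg_apply]
    split_ifs <;> omega

theorem betti_slideDeg (P : Pullback M N (fun d => d - b)) (i : ℕ) (a : Fin n →₀ ℕ) :
    M.betti i a = N.betti i (slideDeg a b) :=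
  (P.torPieceEquiv (koszulCompatible_slideDeg a b) i).finrank_eq

/-- Degrees missed by `a ↦ a ◁ b` are the ones in which the Koszul complex of the slide is exact, so
nothing is lost by ignoring them. -/
theorem exists_slideDeg_or (b d : Fin n →₀ ℕ) :
    (∃ a, d = slideDeg a b) ∨ ∃ i, d i ≠ 0 ∧ d i ≤ b i := by
  by_contra! h
  refine h.1 (d - b) (Finsupp.ext fun i => ?_)
  have := h.2 i
  rw [slideDeg_apply, Finsupp.tsub_apply]
  split_ifs <;> omega

/-- When `e_i < b_i`, truncation sends `e` and `e + e_i` to the same degree, so `x_i` corresponds to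
the identity of `M_{e-b}`. -/
theorem bijOn_of_pullback_tsub (P : Pullback M N (fun d => d - b)) {i : Fin n}
    {e : Fin n →₀ ℕ} (he : e i < b i) :
    Set.BijOn (fun m : N => (MvPolynomial.X i : MvPolynomial (Fin n) k) • m)
        (N.piece e) (N.piece (e + Finsupp.single i 1)) := by
  have heq : e + Finsupp.single i 1 - b = e - b := by
    ext j
    by_cases hj : i = j
    · subst hj; simp; omega
    · simp [hj]
  have h1 := P.bijOn e
  have h2 := P.bijOn (e + Finsupp.single i 1)
  have h3 : ∀ m ∈ M.piece (e - b), P.toFun (e + Finsupp.single i 1) m =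
      (MvPolynomial.X i : MvPolynomial (Fin n) k) • P.toFun e m := by
    intro m hm
    have := P.map_monomial (le_self_add : e ≤ e + Finsupp.single i 1) m hm
    simp only [heq, tsub_self, add_tsub_cancel_left] at this
    rwa [monomial_zero_smul] at this
  simp only [heq] at h2
  have h4 := (h2.congr h3)
  exact (Set.bijOn_comp_iff h1.injOn (g := fun m : N =>
    (MvPolynomial.X i : MvPolynomial (Fin n) k) • m)).1 h4 |> fun h => h1.image_eq ▸ h

theorem koszul_exact_of_le (P : Pullback M N (fun d => d - b)) {i : Fin n} {d : Fin n →₀ ℕ}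
    (hd : d i ≠ 0) (hdb : d i ≤ b i) (r : ℕ) : N.koszulCycles r d ≤ N.koszulBoundaries r d :=
  N.koszulCycles_le_koszulBoundaries hd (fun e he => bijOn_of_pullback_tsub P (by omega)) r

theorem betti_eq_zero_of_le (P : Pullback M N (fun d => d - b)) {i : Fin n} {d : Fin n →₀ ℕ}
    (hd : d i ≠ 0) (hdb : d i ≤ b i) (r : ℕ) : N.betti r d = 0 := by
  have := (N.subsingleton_torPiece_iff r d).2 (koszul_exact_of_le P hd hdb r)
  exact Module.finrank_zero_of_subsingleton

theorem sreg_eq (P : Pullback M N (fun d => d - b)) : M.sreg = N.sreg := by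
  unfold sreg
  refine iSup_congr fun i => le_antisymm ?_ ?_
  · refine iSup₂_le fun a ha => ?_
    rw [betti_slideDeg P] at ha
    refine le_iSup₂_of_le (slideDeg a b) ha ?_
    rw [support_slideDeg]
  · refine iSup₂_le fun d hd => ?_
    obtain ⟨a, rfl⟩ | ⟨j, hj, hjb⟩ := exists_slideDeg_or b d
    · rw [← betti_slideDeg P] at hd
      refine le_iSup₂_of_le a hd ?_
      rw [support_slideDeg]
    · exact absurd (betti_eq_zero_of_le P hj hjb i) hd

/-- Exactness of all graded Koszul complexes in homological degree `r`. -/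
theorem koszul_exact_iff (P : Pullback M N (fun d => d - b)) (r : ℕ) :
    (∀ d, M.koszulCycles r d ≤ M.koszulBoundaries r d) ↔
      ∀ d, N.koszulCycles r d ≤ N.koszulBoundaries r d := by
  have key : ∀ a, M.koszulCycles r a ≤ M.koszulBoundaries r a ↔
      N.koszulCycles r (slideDeg a b) ≤ N.koszulBoundaries r (slideDeg a b) := fun a => by
    rw [← subsingleton_torPiece_iff, ← subsingleton_torPiece_iff]
    exact (P.torPieceEquiv (koszulCompatible_slideDeg a b) r).toEquiv.subsingleton_congr
  constructor
  · intro h d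
    obtain ⟨a, rfl⟩ | ⟨j, hj, hjb⟩ := exists_slideDeg_or b d
    · exact (key a).1 (h a)
    · exact koszul_exact_of_le P hj hjb r
  · exact fun h a => (key a).2 (h _)

end Slide

end NGradedModule

/-! ### Krull dimension through primes generated by variables. -/

namespace NGradedModule

universe u v w

variable {k : Type u} [Field k] {n : ℕ}

/-- Building `B` up one element at a time gives a chain of length `#B`. It is used for chains of
primes generated by variables. -/
theorem card_le_height {ι α : Type*} [Preorder α] (g : Finset ι → α) (hg : StrictMono g)
    (B : Finset ι) : (B.card : ℕ∞) ≤ Order.height (g B) := by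
  classical
  induction B using Finset.induction_on with
  | empty => simp
  | insert i B hi ih =>
    rw [Finset.card_insert_of_notMem hi]
    push_cast
    exact (add_le_add_left ih 1).trans (Order.height_add_one_le (hg (Finset.ssubset_insert hi)))

section VariablePrimes

variable (k) in
/-- The substitution setting the variables in `A` to zero. -/
noncomputable def killVars (A : Finset (Fin n)) :
    MvPolynomial (Fin n) k →ₐ[k] MvPolynomial (Fin n) k :=
  MvPolynomial.aeval fun i => if i ∈ A then 0 else MvPolynomial.X i

variable (k) in
/-- The prime ideal generated by the variables in `A`. -/
noncomputable def varPrime (A : Finset (Fin n)) : PrimeSpectrum (MvPolynomial (Fin n) k) :=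
  ⟨RingHom.ker (killVars k A), RingHom.ker_isPrime _⟩

theorem X_mem_varPrime {A : Finset (Fin n)} {i : Fin n} :
    MvPolynomial.X i ∈ (varPrime k A).asIdeal ↔ i ∈ A := by
  simp only [varPrime, RingHom.mem_ker, killVars, MvPolynomial.aeval_X]
  split_ifs with h <;> simp [h, MvPolynomial.X_ne_zero]

/-- Modulo `p`, setting the variables of `A` to zero changes nothing, so whatever that substitution
kills lies in `p`. -/
theorem varPrime_le {A : Finset (Fin n)} {p : PrimeSpectrum (MvPolynomial (Fin n) k)}
    (h : ∀ i ∈ A, MvPolynomial.X i ∈ p.asIdeal) : varPrime k A ≤ p := by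
  intro f hf
  have key : (Ideal.Quotient.mkₐ k p.asIdeal).comp (killVars k A) =
      Ideal.Quotient.mkₐ k p.asIdeal := by
    refine MvPolynomial.algHom_ext fun i => ?_
    simp only [killVars, AlgHom.comp_apply, MvPolynomial.aeval_X]
    split_ifs with hi
    · rw [map_zero]
      exact (Ideal.Quotient.eq_zero_iff_mem.2 (h i hi)).symm
    · rfl
  have := DFunLike.congr_fun key f
  have hf' : killVars k A f = 0 := hf
  rw [AlgHom.comp_apply, hf', map_zero] at this
  exact Ideal.Quotient.eq_zero_iff_mem.1 this.symm

theorem varPrime_strictMono : StrictMono (varPrime (n := n) k) := by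
  intro A B hAB
  refine lt_of_le_not_ge (varPrime_le fun i hi => X_mem_varPrime.2 (hAB.1 hi)) fun h => ?_
  obtain ⟨i, hiB, hiA⟩ := Finset.exists_of_ssubset hAB
  exact hiA (X_mem_varPrime.1 (h (X_mem_varPrime.2 hiB)))

theorem exists_mem_support_of_notMem_varPrime {A : Finset (Fin n)}
    {f : MvPolynomial (Fin n) k} (hf : f ∉ (varPrime k A).asIdeal) :
    ∃ e ∈ f.support, ∀ i ∈ A, e i = 0 := by
  by_contra! h
  apply hf
  change killVars k A f = 0
  rw [killVars, MvPolynomial.aeval_def, MvPolynomial.eval₂_eq]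
  refine Finset.sum_eq_zero fun e he => ?_
  obtain ⟨i, hi, hei⟩ := h e he
  rw [Finset.prod_eq_zero (i := i), mul_zero]
  · simpa using hei
  · rw [if_pos hi, zero_pow hei]

end VariablePrimes

section Dim

variable (M : NGradedModule.{u, v} k n)

/-- Some homogeneous element is not annihilated by any monomial in the variables of `Z`. -/
def Survives (Z : Finset (Fin n)) : Prop :=
  ∃ d, ∃ m ∈ M.piece d, ∀ e : Fin n →₀ ℕ, (∀ i ∉ Z, e i = 0) →
    MvPolynomial.monomial e (1 : k) • m ≠ 0

/-- Distinct monomials move a homogeneous element to distinct degrees. Hence if `f` kills it, so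
does every monomial occurring in `f`. -/
theorem proj_smul_of_mem {d : Fin n →₀ ℕ} {m : M} (hm : m ∈ M.piece d)
    (f : MvPolynomial (Fin n) k) (e : Fin n →₀ ℕ) :
    M.proj (e + d) (f • m) = f.coeff e • MvPolynomial.monomial e (1 : k) • m := by
  induction f using MvPolynomial.induction_on' with
  | monomial u a =>
    rw [show MvPolynomial.monomial u a = a • MvPolynomial.monomial u (1 : k) by
      rw [MvPolynomial.smul_monomial, smul_eq_mul, mul_one], smul_assoc, map_smul,
      MvPolynomial.coeff_smul, MvPolynomial.coeff_monomial]
    have hmem := M.monomial_smul_mem u d m hm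
    split_ifs with h
    · subst h
      rw [M.proj_of_mem hmem, smul_eq_mul, mul_one]
    · rw [M.proj_of_mem_ne hmem (by simpa using h)]
      simp
  | add p q hp hq => rw [add_smul, map_add, hp, hq, MvPolynomial.coeff_add, add_smul]

theorem varPrime_compl_mem_support {Z : Finset (Fin n)} (h : M.Survives Z) :
    varPrime k Zᶜ ∈ Module.support (MvPolynomial (Fin n) k) M := by
  obtain ⟨d, m, hm, hZ⟩ := h
  rw [Module.mem_support_iff_exists_annihilator]
  refine ⟨m, fun f hf => ?_⟩
  rw [Submodule.mem_annihilator_span_singleton] at hf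
  by_contra hcon
  obtain ⟨e, he, heZ⟩ := exists_mem_support_of_notMem_varPrime hcon
  have := M.proj_smul_of_mem hm f e
  rw [hf, map_zero, eq_comm, smul_eq_zero] at this
  refine this.elim (MvPolynomial.mem_support_iff.1 he) (hZ e fun i hi => heZ i ?_)
  simpa using hi

/-- The prime generated by the variables outside `Z` is in the support, hence so are all larger
primes; adjoining the variables of `Z` one by one gives a chain of length `#Z`. -/
theorem card_le_dim {Z : Finset (Fin n)} (h : M.Survives Z) :
    (Z.card : WithBot ℕ∞) ≤ M.dim := by
  have hmem : ∀ A : Finset Z, varPrime k (Zᶜ ∪ A.map (Function.Embedding.subtype _)) ∈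
      Module.support (MvPolynomial (Fin n) k) M := fun A =>
    Module.mem_support_mono (varPrime_strictMono.monotone Finset.subset_union_left)
      (M.varPrime_compl_mem_support h)
  have hmono : StrictMono fun A : Finset Z =>
      (⟨_, hmem A⟩ : Module.support (MvPolynomial (Fin n) k) M) := by
    intro A B hAB
    refine Subtype.mk_lt_mk.2 (varPrime_strictMono ?_)
    refine ⟨Finset.union_subset_union_right (Finset.map_subset_map.2 hAB.1), fun hsub => ?_⟩
    obtain ⟨i, hiB, hiA⟩ := Finset.exists_of_ssubset hAB
    have := hsub (Finset.mem_union_right _ (Finset.mem_map_of_mem _ hiB))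
    rw [Finset.mem_union] at this
    rcases this with h | h
    · simp at h
    · exact hiA ((Finset.mem_map' _).1 h)
  have := card_le_height _ hmono Finset.univ
  rw [Finset.card_univ, Fintype.card_coe] at this
  exact (WithBot.coe_le_coe.2 this).trans (Order.height_le_krullDim _)

/-- Homogeneous elements span, so `p` contains the annihilator of one of them. Take `Z` to be the
variables outside `p`: a monomial in `Z` is not in the prime `p`, so it cannot kill that element. -/
theorem exists_survives_of_mem_support {p : PrimeSpectrum (MvPolynomial (Fin n) k)}
    (hp : p ∈ Module.support (MvPolynomial (Fin n) k) M) :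
    ∃ Z, M.Survives Z ∧ ∀ i ∉ Z, MvPolynomial.X i ∈ p.asIdeal := by
  classical
  have hspan : Submodule.span (MvPolynomial (Fin n) k) {m : M | ∃ d, m ∈ M.piece d} = ⊤ := by
    rw [eq_top_iff]
    intro m _
    obtain ⟨s, hs⟩ := M.exists_sum_proj m
    rw [hs s subset_rfl]
    exact Submodule.sum_mem _ fun d _ => Submodule.subset_span ⟨d, M.proj_mem d m⟩
  obtain ⟨m, ⟨d, hm⟩, hann⟩ := (Module.mem_support_iff_of_span_eq_top hspan).1 hp
  refine ⟨Finset.univ.filter fun i => MvPolynomial.X i ∉ p.asIdeal, ⟨d, m, hm, ?_⟩, ?_⟩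
  · intro e he h0
    have hmem := hann ((Submodule.mem_annihilator_span_singleton _ _).2 h0)
    rw [MvPolynomial.monomial_eq, map_one, one_mul, Finsupp.prod, p.2.prod_mem_iff] at hmem
    obtain ⟨i, hi, hmem⟩ := hmem
    have := he i (by simpa using p.2.mem_of_pow_mem _ hmem)
    simp [this] at hi
  · intro i hi
    simpa using hi

theorem height_add_coheight_le (p : PrimeSpectrum (MvPolynomial (Fin n) k)) :
    Order.height p + Order.coheight p ≤ n := by
  have hdim := MvPolynomial.ringKrullDim_of_isNoetherianRing (R := k) (ι := Fin n)
  have : Nonempty (PrimeSpectrum (MvPolynomial (Fin n) k)) := ⟨p⟩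
  rw [ringKrullDim_eq_zero_of_field, zero_add, Nat.card_fin, ringKrullDim,
    Order.krullDim_eq_iSup_height_add_coheight_of_nonempty] at hdim
  have h4 := WithBot.coe_injective (hdim.trans (WithBot.coe_natCast n).symm)
  rw [← h4]
  exact le_iSup (fun a : PrimeSpectrum (MvPolynomial (Fin n) k) =>
    Order.height a + Order.coheight a) p

/-- The variables outside `Z` force height at least `n - #Z`, while height plus coheight is at most
`n`. -/
theorem coheight_le_card {p : PrimeSpectrum (MvPolynomial (Fin n) k)} {Z : Finset (Fin n)}
    (hZp : ∀ i ∉ Z, MvPolynomial.X i ∈ p.asIdeal) : Order.coheight p ≤ Z.card := by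
  have h1 : ((Zᶜ.card : ℕ) : ℕ∞) ≤ Order.height p :=
    (card_le_height _ varPrime_strictMono Zᶜ).trans
      (Order.height_mono (varPrime_le fun i hi => hZp i (by simpa using hi)))
  have h5 : (Zᶜ.card : ℕ∞) + Order.coheight p ≤ (Zᶜ.card : ℕ∞) + Z.card := by
    refine (add_le_add_left h1 _).trans ((height_add_coheight_le p).trans ?_)
    rw [← Nat.cast_add, Finset.card_compl_add_card, Fintype.card_fin]
  exact (ENat.add_le_add_iff_left (by simp)).1 h5

theorem dim_eq_iSup :
    M.dim = ⨆ (Z : Finset (Fin n)) (_ : M.Survives Z), (Z.card : WithBot ℕ∞) := by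
  refine le_antisymm ?_ (iSup₂_le fun Z hZ => M.card_le_dim hZ)
  rw [dim, Module.supportDim, Order.krullDim_eq_iSup_coheight]
  refine iSup_le fun p => ?_
  obtain ⟨Z, hZ, hZp⟩ := M.exists_survives_of_mem_support p.2
  have h2 : Order.coheight p ≤ Order.coheight p.1 :=
    Order.coheight_le_coheight_apply_of_strictMono Subtype.val (fun _ _ h => h) _
  have h3 := WithBot.coe_le_coe.2 (h2.trans (coheight_le_card hZp))
  rw [WithBot.coe_natCast] at h3
  exact h3.trans (le_iSup₂ (f := fun (Z : Finset (Fin n)) (_ : M.Survives Z) =>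
    (Z.card : WithBot ℕ∞)) Z hZ)

end Dim

section Slide

variable {M : NGradedModule.{u, v} k n} {N : NGradedModule.{u, w} k n} {b : Fin n →₀ ℕ}

/-- An element of `M_d` is moved to degree `d + b` of `N`, where truncation is invisible to further
multiplication. Conversely, a monomial acting on `N` may lose up to `b` in its exponent when read in
`M`. -/
theorem survives_iff (P : Pullback M N (fun d => d - b)) (Z : Finset (Fin n)) :
    M.Survives Z ↔ N.Survives Z := by
  classical
  have hsm : ∀ d e (m : M), m ∈ M.piece (d - b) →
      (MvPolynomial.monomial e (1 : k) • P.toFun d m = 0 ↔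
        MvPolynomial.monomial ((e + d - b) - (d - b)) (1 : k) • m = 0) := by
    intro d e m hm
    have h := P.map_monomial (le_add_self : d ≤ e + d) m hm
    rw [add_tsub_cancel_right] at h
    rw [← h, P.toFun_eq_zero_iff]
    have := M.monomial_smul_mem ((e + d - b) - (d - b)) _ m hm
    rwa [tsub_add_cancel_of_le (tsub_le_tsub_right le_add_self b)] at this
  constructor
  · rintro ⟨d, m, hm, hZ⟩
    have hm' : m ∈ M.piece (d + b - b) := by rwa [add_tsub_cancel_right]
    refine ⟨d + b, P.toFun (d + b) m, P.toFun_mem hm', fun e he => ?_⟩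
    rw [Ne, hsm _ _ _ hm', ← add_assoc, add_tsub_cancel_right, add_tsub_cancel_right,
      add_tsub_cancel_right]
    exact hZ e he
  · rintro ⟨d, y, hy, hZ⟩
    obtain ⟨m, hm, rfl⟩ := P.exists_toFun_eq hy
    refine ⟨d - b, m, hm, fun e he h0 => ?_⟩
    -- Enlarging the exponent by `b` on `Z` compensates the truncation: read in `M`, it is still at
    -- least `e`.
    refine hZ ((e + b).filter (· ∈ Z)) (fun i hi => by simp [hi]) ?_
    rw [hsm _ _ _ hm]
    have hle : e ≤ (e + b).filter (· ∈ Z) + d - b - (d - b) := by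
      intro i
      by_cases hi : i ∈ Z
      · simp [hi]; omega
      · simp [he i hi]
    rw [← tsub_add_cancel_of_le hle, ← monomial_smul_monomial_smul, h0, smul_zero]

theorem dim_eq (P : Pullback M N (fun d => d - b)) : M.dim = N.dim := by
  simp only [dim_eq_iSup, survives_iff P]

end Slide

end NGradedModule

/-! ### Koszul complexes over a commutative ring and depth. -/

namespace NGradedModule

section Koszul

variable {R : Type*} [CommRing R] {n : ℕ} (x : Fin n → R)
variable {E E' : Type*} [AddCommGroup E] [Module R E] [AddCommGroup E'] [Module R E']

/-- The differential of the Koszul complex of the sequence `x` on the module `E`. -/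
def koszulDiff : (Finset (Fin n) → E) →ₗ[R] (Finset (Fin n) → E) where
  toFun u G := ∑ j ∈ Gᶜ, (-1 : R) ^ (G.filter (· < j)).card • x j • u (insert j G)
  map_add' u v := by
    funext G
    simp [smul_add, Finset.sum_add_distrib]
  map_smul' r u := by
    funext G
    simp only [Pi.smul_apply, RingHom.id_apply, Finset.smul_sum]
    refine Finset.sum_congr rfl fun j _ => ?_
    rw [smul_comm r, smul_comm r]

theorem koszulDiff_apply (u : Finset (Fin n) → E) (G : Finset (Fin n)) :
    koszulDiff x u G =
      ∑ j ∈ Gᶜ, (-1 : R) ^ (G.filter (· < j)).card • x j • u (insert j G) := rfl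

theorem koszulSign_mul_of_lt {G : Finset (Fin n)} {p q : Fin n} (hp : p ∉ G) (hpq : p < q) :
    (-1 : R) ^ (G.filter (· < p)).card * (-1 : R) ^ ((insert p G).filter (· < q)).card =
      -((-1 : R) ^ (G.filter (· < q)).card * (-1 : R) ^ ((insert q G).filter (· < p)).card) := by
  rw [Finset.filter_insert, if_pos hpq, Finset.filter_insert, if_neg hpq.not_gt,
    Finset.card_insert_of_notMem (by simp [hp])]
  ring

theorem koszulSign_mul {G : Finset (Fin n)} {p q : Fin n} (hp : p ∉ G) (hq : q ∉ G)
    (hpq : p ≠ q) :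
    (-1 : R) ^ (G.filter (· < p)).card * (-1 : R) ^ ((insert p G).filter (· < q)).card =
      -((-1 : R) ^ (G.filter (· < q)).card * (-1 : R) ^ ((insert q G).filter (· < p)).card) := by
  rcases lt_or_gt_of_ne hpq with h | h
  · exact koszulSign_mul_of_lt hp h
  · rw [koszulSign_mul_of_lt hq h, neg_neg]

theorem koszulDiff_koszulDiff (u : Finset (Fin n) → E) : koszulDiff x (koszulDiff x u) = 0 := by
  funext G
  simp only [koszulDiff_apply, Finset.smul_sum, Pi.zero_apply]
  rw [Finset.sum_sigma']
  refine Finset.sum_involution (fun p _ => ⟨p.2, p.1⟩) ?_ ?_ ?_ ?_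
  · rintro ⟨j, l⟩ h
    simp only [Finset.mem_sigma, Finset.mem_compl, Finset.mem_insert, not_or] at h
    obtain ⟨hj, hlj, hl⟩ := h
    dsimp only
    rw [Finset.insert_comm l j]
    simp only [smul_smul]
    rw [← add_smul]
    convert zero_smul R (u (insert j (insert l G))) using 2
    linear_combination (x j * x l) * koszulSign_mul (R := R) hj hl (Ne.symm hlj)
  · rintro ⟨j, l⟩ h _ h'
    simp only [Finset.mem_sigma, Finset.mem_compl, Finset.mem_insert, not_or] at h
    simp only [Sigma.mk.injEq] at h'
    exact h.2.1 h'.1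
  · rintro ⟨j, l⟩ h
    simp only [Finset.mem_sigma, Finset.mem_compl, Finset.mem_insert, not_or] at h ⊢
    exact ⟨h.2.2, fun e => h.2.1 e.symm, h.1⟩
  · rintro ⟨j, l⟩ _
    rfl

theorem koszulDiff_comp (f : E →ₗ[R] E') (u : Finset (Fin n) → E) :
    koszulDiff x (fun G => f (u G)) = fun G => f (koszulDiff x u G) := by
  funext G
  simp [koszulDiff_apply]

/-- The chain is concentrated in homological degree `r`. -/
def IsChain (r : ℕ) (u : Finset (Fin n) → E) : Prop := ∀ G, G.card ≠ r → u G = 0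

variable (E) in
/-- Exactness of the Koszul complex of `x` on `E` in homological degree `r`. -/
def KoszulExact (r : ℕ) : Prop :=
  ∀ u : Finset (Fin n) → E, IsChain r u → koszulDiff x u = 0 →
    ∃ v : Finset (Fin n) → E, IsChain (r + 1) v ∧ koszulDiff x v = u

variable {x}

theorem IsChain.koszulDiff {r : ℕ} {u : Finset (Fin n) → E} (hu : IsChain (r + 1) u) :
    IsChain r (koszulDiff x u) := by
  intro G hG
  rw [koszulDiff_apply]
  refine Finset.sum_eq_zero fun j hj => ?_
  rw [hu, smul_zero, smul_zero]
  rw [Finset.card_insert_of_notMem (Finset.mem_compl.1 hj)]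
  omega

theorem IsChain.koszulDiff_eq_zero {u : Finset (Fin n) → E} (hu : IsChain 0 u) :
    NGradedModule.koszulDiff x u = 0 := by
  funext G
  rw [koszulDiff_apply]
  refine Finset.sum_eq_zero fun j hj => ?_
  rw [hu, smul_zero, smul_zero]
  rw [Finset.card_insert_of_notMem (Finset.mem_compl.1 hj)]
  omega

theorem IsChain.sub {r : ℕ} {u v : Finset (Fin n) → E} (hu : IsChain r u) (hv : IsChain r v) :
    IsChain r (u - v) := fun G hG => by
  rw [Pi.sub_apply, hu G hG, hv G hG, sub_zero]

theorem IsChain.eq_zero_of_lt {r : ℕ} {u : Finset (Fin n) → E} (hu : IsChain r u) (h : n < r) :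
    u = 0 := by
  funext G
  refine hu G fun hG => ?_
  have := Finset.card_le_univ G
  rw [Fintype.card_fin] at this
  omega

/-- Multiplication by `x_j` is null-homotopic. -/
theorem exists_koszulDiff_eq_smul (j : Fin n) {r : ℕ} {z : Finset (Fin n) → E}
    (hz : IsChain r z) (hDz : koszulDiff x z = 0) :
    ∃ v : Finset (Fin n) → E, IsChain (r + 1) v ∧ koszulDiff x v = x j • z := by
  -- The witness is `e_j ∧ z`. With `h = e_j ∧ -` one has `Dh + hD = x_j`, and `Dz = 0`.
  refine ⟨fun G => if j ∈ G then (-1 : R) ^ ((G.erase j).filter (· < j)).card • z (G.erase j)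
    else 0, fun G hG => ?_, funext fun G => ?_⟩
  · dsimp only
    split_ifs with h
    · rw [hz, smul_zero]
      have := Finset.card_erase_add_one h
      omega
    · rfl
  · rw [koszulDiff_apply, Pi.smul_apply]
    by_cases h : j ∈ G
    · obtain ⟨H, hH, rfl⟩ : ∃ H, j ∉ H ∧ insert j H = G :=
        ⟨G.erase j, Finset.notMem_erase j G, Finset.insert_erase h⟩
      have hD := congrArg (fun y => (-1 : R) ^ (H.filter (· < j)).card • y) (congrFun hDz H)
      simp only [Pi.zero_apply, smul_zero] at hD
      rw [koszulDiff_apply, ← Finset.add_sum_erase _ _ (Finset.mem_compl.2 hH), smul_add,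
        neg_one_pow_smul_smul, Finset.smul_sum] at hD
      rw [eq_comm, ← sub_eq_zero, ← hD, sub_eq_add_neg, ← Finset.sum_neg_distrib]
      congr 1
      have hset : (insert j H)ᶜ = Hᶜ.erase j := by
        ext l; simp
      rw [hset]
      refine Finset.sum_congr rfl fun l hl => ?_
      simp only [Finset.mem_erase, Finset.mem_compl] at hl
      have h1 : (insert l (insert j H)).erase j = insert l H := by
        ext a
        simp only [Finset.mem_erase, Finset.mem_insert]
        constructor
        · rintro ⟨h1, h2 | h2 | h2⟩
          · exact Or.inl h2
          · exact absurd h2 h1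
          · exact Or.inr h2
        · rintro (h2 | h2)
          · exact ⟨h2 ▸ hl.1, Or.inl h2⟩
          · exact ⟨fun h3 => hH (h3 ▸ h2), Or.inr (Or.inr h2)⟩
      rw [if_pos (by simp), h1]
      simp only [smul_smul]
      rw [← neg_smul]
      congr 1
      have key := koszulSign_mul (R := R) hH hl.2 (Ne.symm hl.1)
      have hjj : (-1 : R) ^ (H.filter (· < j)).card * (-1 : R) ^ (H.filter (· < j)).card = 1 := by
        rw [← mul_pow]; simp
      have hdd : (-1 : R) ^ ((insert l H).filter (· < j)).card *
          (-1 : R) ^ ((insert l H).filter (· < j)).card = 1 := by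
        rw [← mul_pow]; simp
      -- With the four signs as indeterminates, only `a² = d² = 1` and the anticommutation `ac =
      -- -bd` are needed.
      generalize (-1 : R) ^ (H.filter (· < j)).card = a at *
      generalize (-1 : R) ^ (H.filter (· < l)).card = b at *
      generalize (-1 : R) ^ ((insert j H).filter (· < l)).card = c at *
      generalize (-1 : R) ^ ((insert l H).filter (· < j)).card = d at *
      linear_combination c * d * x l * hjj + a * b * x l * hdd - d * a * x l * key
    · rw [Finset.sum_eq_single j]
      · rw [if_pos (Finset.mem_insert_self _ _), Finset.erase_insert h, smul_comm (x j),
          neg_one_pow_smul_smul]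
      · intro l _ hl
        rw [if_neg (by simp [h, Ne.symm hl]), smul_zero, smul_zero]
      · intro h'
        exact absurd (Finset.mem_compl.2 h) h'

theorem exists_koszulDiff_eq_smul_of_mem {a : R} (ha : a ∈ Ideal.span (Set.range x)) {r : ℕ}
    {z : Finset (Fin n) → E} (hz : IsChain r z) (hDz : koszulDiff x z = 0) :
    ∃ v : Finset (Fin n) → E, IsChain (r + 1) v ∧ koszulDiff x v = a • z := by
  induction ha using Submodule.span_induction with
  | mem a ha =>
    obtain ⟨j, rfl⟩ := ha
    exact exists_koszulDiff_eq_smul j hz hDz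
  | zero => exact ⟨0, fun _ _ => rfl, by rw [map_zero, zero_smul]⟩
  | add a b _ _ iha ihb =>
    obtain ⟨u, hu, hDu⟩ := iha
    obtain ⟨v, hv, hDv⟩ := ihb
    refine ⟨u + v, fun G hG => ?_, by rw [map_add, hDu, hDv, add_smul]⟩
    rw [Pi.add_apply, hu G hG, hv G hG, add_zero]
  | smul b a _ ih =>
    obtain ⟨u, hu, hDu⟩ := ih
    refine ⟨b • u, fun G hG => ?_, by rw [map_smul, hDu, smul_eq_mul, mul_smul]⟩
    rw [Pi.smul_apply, hu G hG, smul_zero]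

theorem exists_lift_chain {π : E →ₗ[R] E'} (hπ : Function.Surjective π) {r : ℕ}
    {u : Finset (Fin n) → E'} (hu : IsChain r u) :
    ∃ v : Finset (Fin n) → E, IsChain r v ∧ (fun G => π (v G)) = u := by
  choose g hg using hπ
  refine ⟨fun G => if G.card = r then g (u G) else 0, fun G hG => if_neg hG, funext fun G => ?_⟩
  dsimp only
  split_ifs with h
  · exact hg _
  · rw [map_zero, hu G h]

theorem exists_chain_smul_eq {a : R} {π : E →ₗ[R] E'} (hker : ∀ e, π e = 0 → ∃ e', a • e' = e)
    {r : ℕ} {u : Finset (Fin n) → E} (hu : IsChain r u) (h : (fun G => π (u G)) = 0) :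
    ∃ v : Finset (Fin n) → E, IsChain r v ∧ a • v = u := by
  choose g hg using fun G => hker (u G) (congrFun h G)
  refine ⟨fun G => if G.card = r then g G else 0, fun G hG => if_neg hG, funext fun G => ?_⟩
  rw [Pi.smul_apply]
  split_ifs with h
  · exact hg G
  · rw [smul_zero, hu G h]

theorem smul_chain_injective {a : R} (hreg : IsSMulRegular E a) {u v : Finset (Fin n) → E}
    (h : a • u = a • v) : u = v :=
  funext fun G => hreg (congrFun h G)

/-- Exactness passes to the quotient by a regular element. -/
theorem KoszulExact.quotient {a : R} (hreg : IsSMulRegular E a) {π : E →ₗ[R] E'}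
    (hπ : Function.Surjective π) (hker : ∀ e, π e = 0 ↔ ∃ e', a • e' = e) {r : ℕ}
    (h : KoszulExact x E r) (h' : ∀ s, s + 1 = r → KoszulExact x E s) : KoszulExact x E' r := by
  intro u hu hDu
  obtain ⟨u, hu₁, rfl⟩ := exists_lift_chain hπ hu
  -- The connecting homomorphism: `Du` is divisible by `a`, and the quotient is a cycle one degree
  -- lower, hence a boundary `Dv`. Then `u - a v` is a cycle lifting the same class. In degree zero
  -- `v = 0` works.
  obtain ⟨v, hv, hDv⟩ : ∃ v : Finset (Fin n) → E, IsChain r v ∧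
      koszulDiff x u = a • koszulDiff x v := by
    cases r with
    | zero =>
      exact ⟨0, fun _ _ => rfl, by rw [hu₁.koszulDiff_eq_zero, map_zero, smul_zero]⟩
    | succ s =>
      rw [koszulDiff_comp] at hDu
      obtain ⟨w, hw, hwu⟩ := exists_chain_smul_eq (fun e => (hker e).1) hu₁.koszulDiff hDu
      have hDw : koszulDiff x w = 0 := by
        refine smul_chain_injective hreg ?_
        rw [← map_smul, hwu, koszulDiff_koszulDiff, smul_zero]
      obtain ⟨v, hv, rfl⟩ := h' s rfl w hw hDw
      exact ⟨v, hv, hwu.symm⟩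
  obtain ⟨w, hw, hDw⟩ := h (u - a • v) (hu₁.sub fun G hG => by
    rw [Pi.smul_apply, hv G hG, smul_zero]) (by rw [map_sub, map_smul, hDv, sub_self])
  refine ⟨fun G => π (w G), fun G hG => by dsimp only; rw [hw G hG, map_zero], ?_⟩
  rw [koszulDiff_comp, hDw]
  funext G
  rw [Pi.sub_apply, map_sub, Pi.smul_apply, (hker (a • v G)).2 ⟨_, rfl⟩, sub_zero]

/-- Exactness of the quotient by a regular element descends, with a shift. -/
theorem KoszulExact.of_quotient {a : R} (hreg : IsSMulRegular E a)
    (ha : a ∈ Ideal.span (Set.range x)) {π : E →ₗ[R] E'}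
    (hπ : Function.Surjective π) (hker : ∀ e, π e = 0 ↔ ∃ e', a • e' = e) {r : ℕ}
    (h : KoszulExact x E' (r + 1)) : KoszulExact x E r := by
  intro z hz hDz
  -- Multiplication by `a` is zero on Koszul homology, so `a z = Dy`. Modulo `a`, `y` is a cycle,
  -- hence a boundary; correcting `y` by a lift `Dv` makes it divisible by `a`, and cancelling `a`
  -- exhibits `z` as a boundary.
  obtain ⟨y, hy, hDy⟩ := exists_koszulDiff_eq_smul_of_mem ha hz hDz
  obtain ⟨v, hv, hDv⟩ := h (fun G => π (y G))
      (fun G hG => by dsimp only; rw [hy G hG, map_zero]) (by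
    rw [koszulDiff_comp, hDy]
    funext G
    exact (hker _).2 ⟨_, rfl⟩)
  obtain ⟨v, hv₁, rfl⟩ := exists_lift_chain hπ hv
  obtain ⟨w, hw, hwy⟩ := exists_chain_smul_eq (fun e => (hker e).1)
    (hy.sub (IsChain.koszulDiff (x := x) hv₁)) (by
      rw [koszulDiff_comp] at hDv
      funext G
      rw [Pi.sub_apply, map_sub, Pi.zero_apply, sub_eq_zero]
      exact (congrFun hDv G).symm)
  refine ⟨w, hw, smul_chain_injective hreg ?_⟩
  rw [← map_smul, hwy, map_sub, koszulDiff_koszulDiff, sub_zero, hDy]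

end Koszul

section Depth

open scoped Pointwise

universe u v

variable {R : Type u} [CommRing R] {n : ℕ} {x : Fin n → R}

theorem mkQ_smul_top_eq_zero_iff {E : Type v} [AddCommGroup E] [Module R E] (a : R) (e : E) :
    (a • (⊤ : Submodule R E)).mkQ e = 0 ↔ ∃ e', a • e' = e := by
  rw [Submodule.mkQ_apply, Submodule.Quotient.mk_eq_zero, Submodule.mem_smul_pointwise_iff_exists]
  simp

theorem smul_top_quotSMulTop_ne_top {E : Type v} [AddCommGroup E] [Module R E] {I : Ideal R}
    (h : I • (⊤ : Submodule R E) ≠ ⊤) {a : R} (ha : a ∈ I) :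
    I • (⊤ : Submodule R (QuotSMulTop a E)) ≠ ⊤ := by
  intro hcon
  apply h
  have hle : a • (⊤ : Submodule R E) ≤ I • ⊤ := by
    intro e he
    obtain ⟨e', -, rfl⟩ := (Submodule.mem_smul_pointwise_iff_exists _ _ _).1 he
    exact Submodule.smul_mem_smul ha trivial
  have h1 : Submodule.map (a • (⊤ : Submodule R E)).mkQ (I • ⊤) = ⊤ := by
    rw [Submodule.map_smul'', Submodule.map_top, Submodule.range_mkQ, hcon]
  have h2 := Submodule.comap_map_mkQ (a • (⊤ : Submodule R E)) (I • ⊤)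
  rw [h1, Submodule.comap_top, sup_eq_right.2 hle] at h2
  exact h2.symm

/-- Prime avoidance: if `I` consisted of zero divisors it would lie in one associated prime, the
annihilator of some `e`, and then `I` would kill the nonzero `e`. -/
theorem exists_isSMulRegular_mem [IsNoetherianRing R] {E : Type v} [AddCommGroup E] [Module R E]
    [Module.Finite R E] {I : Ideal R} (h : ∀ e : E, (∀ a ∈ I, a • e = 0) → e = 0) :
    ∃ a ∈ I, IsSMulRegular E a := by
  by_contra! hcon
  have hsub : (I : Set R) ⊆ ⋃ p ∈ associatedPrimes R E, p := by
    rw [biUnion_associatedPrimes_eq_zero_divisors]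
    intro a ha
    have := hcon a ha
    rw [isSMulRegular_iff_right_eq_zero_of_smul] at this
    push Not at this
    obtain ⟨e, h1, h2⟩ := this
    exact ⟨e, h2, h1⟩
  obtain ⟨p, hp, hIp⟩ := (Ideal.subset_union_prime_finite (associatedPrimes.finite R E) (f := id)
    0 0 fun p hp _ _ => hp.isPrime).1 hsub
  obtain ⟨hprime, e, rfl⟩ := isAssociatedPrime_iff.1 hp
  have he : e = 0 := h e fun a ha => by simpa using hIp ha
  subst he
  exact hprime.ne_top (by ext; simp)

/-- The depth of a finite module, by the vanishing of Koszul homology. -/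
theorem exists_isRegular_iff_koszulExact [IsNoetherianRing R] (t : ℕ) :
    ∀ (E : Type v) [AddCommGroup E] [Module R E] [Module.Finite R E],
      Ideal.span (Set.range x) • (⊤ : Submodule R E) ≠ ⊤ →
      ((∃ rs : List R, (∀ r ∈ rs, r ∈ Ideal.span (Set.range x)) ∧
        RingTheory.Sequence.IsRegular E rs ∧ rs.length = t) ↔
        ∀ r, n < r + t → KoszulExact x E r) := by
  induction t with
  | zero =>
    intro E _ _ _ hE
    refine ⟨fun _ r hr u hu _ => ⟨0, fun _ _ => rfl, ?_⟩, fun _ => ⟨[], by simp, ?_, rfl⟩⟩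
    · rw [hu.eq_zero_of_lt hr, map_zero]
    · have : Nontrivial E := by
        by_contra hn
        rw [not_nontrivial_iff_subsingleton] at hn
        exact hE (Subsingleton.elim _ _)
      exact RingTheory.Sequence.IsRegular.nil R E
  | succ t ih =>
    intro E _ _ _ hE
    constructor
    · rintro ⟨rs, hrs, hreg, hlen⟩ r hr
      cases rs with
      | nil => simp at hlen
      | cons a rs =>
        rw [RingTheory.Sequence.isRegular_cons_iff] at hreg
        have ha := hrs a (by simp)
        have := (ih (QuotSMulTop a E) (smul_top_quotSMulTop_ne_top hE ha)).1
          ⟨rs, fun r hr => hrs r (by simp [hr]), hreg.2, by simpa using hlen⟩ (r + 1) (by omega)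
        exact this.of_quotient hreg.1 ha (Submodule.mkQ_surjective _) (mkQ_smul_top_eq_zero_iff a)
    · intro h
      -- Top Koszul homology consists of the elements killed by all `x_j`: such an `e`, placed on
      -- the full index set, is a cycle in degree `n`, and there are no chains in degree `n + 1` to
      -- bound it unless `e = 0`.
      obtain ⟨a, ha, hreg⟩ := exists_isSMulRegular_mem (R := R) (E := E)
        (I := Ideal.span (Set.range x)) (by
          intro e he
          obtain ⟨v, hv, hDv⟩ := h n (by omega) (fun G => if G = Finset.univ then e else 0)
            (fun G hG => if_neg fun h => hG (by rw [h, Finset.card_fin])) (by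
              funext G
              rw [koszulDiff_apply]
              refine Finset.sum_eq_zero fun j _ => ?_
              split_ifs
              · rw [he _ (Ideal.subset_span ⟨j, rfl⟩), smul_zero]
              · rw [smul_zero, smul_zero])
          rw [hv.eq_zero_of_lt (Nat.lt_succ_self n), map_zero] at hDv
          simpa using (congrFun hDv Finset.univ).symm)
      obtain ⟨rs, hrs, hrsreg, hlen⟩ :=
        (ih (QuotSMulTop a E) (smul_top_quotSMulTop_ne_top hE ha)).2 fun r hr =>
          (h r (by omega)).quotient hreg (Submodule.mkQ_surjective _)
            (mkQ_smul_top_eq_zero_iff a) fun s hs => h s (by omega)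
      refine ⟨a :: rs, ?_, (RingTheory.Sequence.isRegular_cons_iff E a rs).2 ⟨hreg, hrsreg⟩,
        by simp [hlen]⟩
      intro r hr
      rcases List.mem_cons.1 hr with rfl | hr
      · exact ha
      · exact hrs r hr

end Depth

/-! ### Comparison of graded and ungraded Koszul exactness; graded Nakayama. -/

section Graded

universe u v w

variable {k : Type u} [Field k] {n : ℕ} (M : NGradedModule.{u, v} k n)

theorem koszulD_eq_koszulDiff (u : Finset (Fin n) → M) :
    M.koszulD u = koszulDiff (MvPolynomial.X : Fin n → MvPolynomial (Fin n) k) u := by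
  funext G
  rw [koszulD_apply, koszulDiff_apply]
  refine Finset.sum_congr rfl fun j _ => ?_
  rcases Nat.even_or_odd (G.filter (· < j)).card with h | h
  · simp [h.neg_one_pow]
  · simp [h.neg_one_pow]

/-- The part of degree `a` of a Koszul chain. -/
noncomputable def chainPart (a : Fin n →₀ ℕ) :
    (Finset (Fin n) → M) →ₗ[k] (Finset (Fin n) → M) :=
  LinearMap.pi fun F =>
    open Classical in (if indicator F ≤ a then M.proj (a - indicator F) else 0) ∘ₗ LinearMap.proj F

theorem chainPart_of_le {a : Fin n →₀ ℕ} {F : Finset (Fin n)} (h : indicator F ≤ a)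
    (u : Finset (Fin n) → M) : M.chainPart a u F = M.proj (a - indicator F) (u F) := by
  simp [chainPart, h]

theorem chainPart_of_not_le {a : Fin n →₀ ℕ} {F : Finset (Fin n)} (h : ¬ indicator F ≤ a)
    (u : Finset (Fin n) → M) : M.chainPart a u F = 0 := by
  simp [chainPart, h]

theorem chainPart_mem {r : ℕ} {u : Finset (Fin n) → M} (hu : IsChain r u) (a : Fin n →₀ ℕ) :
    M.chainPart a u ∈ M.koszulChains r a := by
  rw [mem_koszulChains]
  intro F
  by_cases h : indicator F ≤ a
  · rw [chainPart_of_le M h]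
    refine ⟨fun _ => M.proj_mem _ _, fun hF => ?_⟩
    rw [hu F (fun hc => hF ⟨hc, h⟩), map_zero]
  · rw [chainPart_of_not_le M h]
    exact ⟨fun hF => absurd hF.2 h, fun _ => rfl⟩

theorem isChain_of_mem {r : ℕ} {a : Fin n →₀ ℕ} {u : Finset (Fin n) → M}
    (hu : u ∈ M.koszulChains r a) : IsChain r u := fun F hF =>
  (M.mem_koszulChains.1 hu F).2 fun h => hF h.1

theorem chainPart_of_mem {r : ℕ} {a : Fin n →₀ ℕ} {u : Finset (Fin n) → M}
    (hu : u ∈ M.koszulChains r a) : M.chainPart a u = u := by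
  rw [mem_koszulChains] at hu
  funext F
  by_cases h : indicator F ≤ a
  · rw [chainPart_of_le M h]
    by_cases hF : F.card = r
    · exact M.proj_of_mem ((hu F).1 ⟨hF, h⟩)
    · rw [(hu F).2 (fun h => hF h.1), map_zero]
  · rw [chainPart_of_not_le M h, (hu F).2 (fun h' => h h'.2)]

theorem koszulD_chainPart (a : Fin n →₀ ℕ) (u : Finset (Fin n) → M) :
    M.koszulD (M.chainPart a u) = M.chainPart a (M.koszulD u) := by
  funext G
  by_cases h : indicator G ≤ a
  · rw [chainPart_of_le M h, koszulD_apply, koszulD_apply, map_sum]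
    refine Finset.sum_congr rfl fun j hj => ?_
    rw [Finset.mem_compl] at hj
    rw [map_smul]
    congr 1
    by_cases hF : indicator (insert j G) ≤ a
    · rw [chainPart_of_le M hF, MvPolynomial.X, ← proj_monomial_smul_add, add_comm,
        tsub_indicator_insert_add hj hF]
    · rw [chainPart_of_not_le M hF, smul_zero, MvPolynomial.X, proj_monomial_smul_of_not_le]
      rw [indicator_insert hj] at hF
      exact fun hle => hF ((le_tsub_iff_left h).1 hle)
  · rw [chainPart_of_not_le M h, koszulD_apply]
    refine Finset.sum_eq_zero fun j hj => ?_
    rw [Finset.mem_compl] at hj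
    rw [chainPart_of_not_le, smul_zero, smul_zero]
    rw [indicator_insert hj]
    exact fun hle => h (le_self_add.trans hle)

theorem exists_sum_chainPart (u : Finset (Fin n) → M) :
    ∃ s : Finset (Fin n →₀ ℕ), u = ∑ a ∈ s, M.chainPart a u := by
  classical
  choose s hs using fun F => M.exists_sum_proj (u F)
  -- The basis vector of `F` has degree `indicator F`, so a part of `u F` in degree `d` belongs to
  -- degree `d + indicator F` of the complex.
  refine ⟨Finset.univ.biUnion fun F => (s F).image (· + indicator F), funext fun F => ?_⟩
  set S := Finset.univ.biUnion fun F => (s F).image (· + indicator F) with hS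
  rw [Finset.sum_apply, ← Finset.sum_filter_add_sum_filter_not S (fun a => indicator F ≤ a),
    Finset.sum_eq_zero (s := S.filter fun a => ¬ indicator F ≤ a), add_zero]
  · rw [hs F ((S.filter fun a => indicator F ≤ a).image (· - indicator F))]
    · rw [Finset.sum_image]
      · refine Finset.sum_congr rfl fun a ha => ?_
        rw [chainPart_of_le M (Finset.mem_filter.1 ha).2]
      · intro a ha b hb hab
        have ha' := (Finset.mem_filter.1 ha).2
        have hb' := (Finset.mem_filter.1 hb).2
        rw [← tsub_add_cancel_of_le ha', ← tsub_add_cancel_of_le hb']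
        exact congrArg (· + indicator F) hab
    · intro d hd
      rw [Finset.mem_image]
      refine ⟨d + indicator F, Finset.mem_filter.2 ⟨?_, le_add_self⟩, add_tsub_cancel_right _ _⟩
      rw [hS, Finset.mem_biUnion]
      exact ⟨F, Finset.mem_univ F, Finset.mem_image_of_mem _ hd⟩
  · intro a ha
    exact M.chainPart_of_not_le (Finset.mem_filter.1 ha).2 u

/-- The differential commutes with taking the part of a given degree, and every chain is a finite
sum of such parts. -/
theorem koszulExact_iff (r : ℕ) :
    KoszulExact (MvPolynomial.X : Fin n → MvPolynomial (Fin n) k) M r ↔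
      ∀ a, M.koszulCycles r a ≤ M.koszulBoundaries r a := by
  constructor
  · rintro h a u ⟨hu, hDu⟩
    obtain ⟨v, hv, rfl⟩ := h u (M.isChain_of_mem hu) (by rw [← koszulD_eq_koszulDiff]; exact hDu)
    refine ⟨M.chainPart a v, M.chainPart_mem hv a, ?_⟩
    rw [koszulD_chainPart, koszulD_eq_koszulDiff]
    exact M.chainPart_of_mem hu
  · intro h u hu hDu
    rw [← koszulD_eq_koszulDiff] at hDu
    obtain ⟨s, hs⟩ := M.exists_sum_chainPart u
    have : ∀ a, ∃ v ∈ M.koszulChains (r + 1) a, M.koszulD v = M.chainPart a u := fun a =>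
      h a ⟨M.chainPart_mem hu a, by
        rw [SetLike.mem_coe, LinearMap.mem_ker, koszulD_chainPart, hDu, map_zero]⟩
    choose v hv hDv using this
    refine ⟨∑ a ∈ s, v a, fun F hF => ?_, ?_⟩
    · rw [Finset.sum_apply]
      exact Finset.sum_eq_zero fun a _ => M.isChain_of_mem (hv a) F hF
    · rw [← koszulD_eq_koszulDiff, map_sum]
      exact (Finset.sum_congr rfl fun a _ => hDv a).trans hs.symm

/-- The graded Nakayama lemma for the ideal of the variables. -/
theorem span_X_smul_top_ne_top [Nontrivial M] :
    Ideal.span (Set.range (MvPolynomial.X : Fin n → MvPolynomial (Fin n) k)) •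
      (⊤ : Submodule (MvPolynomial (Fin n) k) M) ≠ ⊤ := by
  intro htop
  obtain ⟨m, hm⟩ := exists_ne (0 : M)
  -- Choose a nonzero component of least total degree: elements of `(x₁, …, xₙ) M` have no part
  -- there. This needs no finite generation.
  have hex : ∃ N : ℕ, ∃ d : Fin n →₀ ℕ, d.degree = N ∧ ∃ m, M.proj d m ≠ 0 := by
    by_contra! h
    exact hm (M.eq_zero_of_proj fun d => h _ d rfl m)
  classical
  obtain ⟨d, hd, m, hm⟩ := Nat.find_spec hex
  have hmin : ∀ e : Fin n →₀ ℕ, e.degree < d.degree → ∀ m, M.proj e m = 0 := by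
    intro e he m
    by_contra hcon
    exact Nat.find_min hex (hd ▸ he) ⟨e, rfl, m, hcon⟩
  have hmem : m ∈ Ideal.span (Set.range (MvPolynomial.X : Fin n → MvPolynomial (Fin n) k)) •
      (⊤ : Submodule (MvPolynomial (Fin n) k) M) := by
    rw [htop]; trivial
  apply hm
  clear hm
  have key : ∀ a ∈ Ideal.span (Set.range (MvPolynomial.X : Fin n → MvPolynomial (Fin n) k)),
      ∀ m : M, M.proj d (a • m) = 0 := by
    intro a ha
    induction ha using Submodule.span_induction with
    | mem a ha =>
      obtain ⟨i, rfl⟩ := ha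
      intro m
      by_cases hi : Finsupp.single i 1 ≤ d
      · rw [MvPolynomial.X, M.proj_monomial_smul hi, hmin, smul_zero]
        conv_rhs => rw [← tsub_add_cancel_of_le hi]
        rw [map_add, Finsupp.degree_single]
        exact Nat.lt_succ_self _
      · rw [MvPolynomial.X, M.proj_monomial_smul_of_not_le hi]
    | zero => intro m; rw [zero_smul, map_zero]
    | add a b _ _ iha ihb => intro m; rw [add_smul, map_add, iha, ihb, add_zero]
    | smul f a _ ih => intro m; rw [smul_eq_mul, mul_comm, mul_smul, ih]
  induction hmem using Submodule.smul_induction_on' with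
  | smul a ha m _ => exact key a ha m
  | add y _ z _ hy hz => rw [map_add, hy, hz, add_zero]

end Graded

section Slide

universe u v w

variable {k : Type u} [Field k] {n : ℕ}
variable {M : NGradedModule.{u, v} k n} {N : NGradedModule.{u, w} k n} {b : Fin n →₀ ℕ}

/-- The zero module is recognized by its dimension `⊥`, already known to agree. -/
theorem nontrivial_iff (P : Pullback M N (fun d => d - b)) : Nontrivial M ↔ Nontrivial N := by
  rw [← Module.supportDim_ne_bot_iff_nontrivial (MvPolynomial (Fin n) k) M,
    ← Module.supportDim_ne_bot_iff_nontrivial (MvPolynomial (Fin n) k) N]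
  exact not_congr (Eq.congr_left (dim_eq P))

theorem exists_isRegular_iff (P : Pullback M N (fun d => d - b))
    [Module.Finite (MvPolynomial (Fin n) k) M] [Module.Finite (MvPolynomial (Fin n) k) N]
    (t : ℕ) :
    (∃ rs : List (MvPolynomial (Fin n) k),
      (∀ r ∈ rs, r ∈ Ideal.span (Set.range (MvPolynomial.X : Fin n → MvPolynomial (Fin n) k))) ∧
      RingTheory.Sequence.IsRegular M rs ∧ rs.length = t) ↔
    (∃ rs : List (MvPolynomial (Fin n) k),
      (∀ r ∈ rs, r ∈ Ideal.span (Set.range (MvPolynomial.X : Fin n → MvPolynomial (Fin n) k))) ∧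
      RingTheory.Sequence.IsRegular N rs ∧ rs.length = t) := by
  by_cases hM : Nontrivial M
  · have hN := (nontrivial_iff P).1 hM
    rw [exists_isRegular_iff_koszulExact t M M.span_X_smul_top_ne_top,
      exists_isRegular_iff_koszulExact t N N.span_X_smul_top_ne_top]
    simp only [koszulExact_iff, koszul_exact_iff P]
  · have hN := mt (nontrivial_iff P).2 hM
    constructor
    · rintro ⟨rs, -, h, -⟩
      exact absurd h.nontrivial hM
    · rintro ⟨rs, -, h, -⟩
      exact absurd h.nontrivial hN

theorem depth_eq (P : Pullback M N (fun d => d - b))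
    [Module.Finite (MvPolynomial (Fin n) k) M] [Module.Finite (MvPolynomial (Fin n) k) N] :
    M.depth = N.depth := by
  unfold depth
  refine le_antisymm (iSup₂_le fun rs h => ?_) (iSup₂_le fun rs h => ?_)
  · obtain ⟨rs', h1, h2, h3⟩ := (exists_isRegular_iff P rs.length).1 ⟨rs, h.1, h.2, rfl⟩
    exact le_iSup₂_of_le rs' ⟨h1, h2⟩ (by rw [h3])
  · obtain ⟨rs', h1, h2, h3⟩ := (exists_isRegular_iff P rs.length).2 ⟨rs, h.1, h.2, rfl⟩
    exact le_iSup₂_of_le rs' ⟨h1, h2⟩ (by rw [h3])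

end Slide

end NGradedModule

/-! ### Finite generation of pullbacks, block bases and quasi Stanley decompositions. -/

namespace NGradedModule

universe u v w

variable {k : Type u} [Field k] {n : ℕ}

/-- Beyond `b + c` the module no longer changes, so `N` is generated by its finitely many,
finite-dimensional components of degree at most `b + c`. -/
theorem finite_of_pullback {M : NGradedModule.{u, v} k n} {N : NGradedModule.{u, w} k n}
    {b c : Fin n →₀ ℕ} (P : Pullback M N (fun d => d - b)) (hM : M.IsPosDetermined c) :
    Module.Finite (MvPolynomial (Fin n) k) N := by
  classical
  have := hM.1
  have hfg : ∀ d, ∃ G : Finset N, Submodule.span k (G : Set N) = N.piece d := by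
    intro d
    have := M.finite_piece (d - b)
    have : Module.Finite k (N.piece d) := Module.Finite.equiv (P.equiv d)
    exact (Submodule.fg_top (N.piece d)).1 Module.Finite.fg_top
  choose G hG using hfg
  refine ⟨⟨(Finset.Iic (b + c)).biUnion G, ?_⟩⟩
  set W := Submodule.span (MvPolynomial (Fin n) k) (((Finset.Iic (b + c)).biUnion G : Finset N) :
    Set N)
  have hsmall : ∀ p ≤ b + c, ∀ y ∈ N.piece p, y ∈ W := by
    intro p hp y hy
    rw [← hG p] at hy
    refine Submodule.span_le_restrictScalars k (MvPolynomial (Fin n) k) _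
      (Submodule.span_mono ?_ hy)
    exact_mod_cast Finset.subset_biUnion_of_mem G (Finset.mem_Iic.2 hp)
  rw [eq_top_iff]
  intro y _
  induction y using N.homogeneous_induction with
  | zero => exact Submodule.zero_mem _
  | add x y hx hy => exact Submodule.add_mem _ (hx trivial) (hy trivial)
  | homogeneous q y hy =>
    obtain ⟨m, hm, rfl⟩ := P.exists_toFun_eq hy
    have hpq : q ⊓ (b + c) ≤ q := inf_le_left
    obtain ⟨m', hm'⟩ := (M.mulMap_bijective hM (tsub_le_tsub_right hpq b) (fun i hi => by
      simp at hi ⊢; omega)).2 ⟨m, hm⟩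
    have h := P.map_monomial hpq m' m'.2
    rw [← coe_mulMap M (tsub_le_tsub_right hpq b) m', hm'] at h
    dsimp only at h
    rw [h]
    exact W.smul_mem _ (hsmall _ inf_le_right _ (P.toFun_mem m'.2))

section BlockBasis

/-- The homogeneous elements `f j d`, for `d ∈ B j`, form a basis of `M`. -/
structure IsBlockBasis (M : NGradedModule.{u, v} k n) {J : Type*} (B : J → Set (Fin n →₀ ℕ))
    (f : J → (Fin n →₀ ℕ) → M) : Prop where
  mem : ∀ j, ∀ d ∈ B j, f j d ∈ M.piece d
  linearIndependent : LinearIndependent k fun p : Σ j, B j => f p.1 p.2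
  span : ⊤ ≤ Submodule.span k (Set.range fun p : Σ j, B j => f p.1 p.2)

namespace IsBlockBasis

variable {M : NGradedModule.{u, v} k n} {N : NGradedModule.{u, w} k n}
variable {J J' : Type*} {B : J → Set (Fin n →₀ ℕ)} {f : J → (Fin n →₀ ℕ) → M}

theorem mem_of_eq (h : IsBlockBasis M B f) {d : Fin n →₀ ℕ} {p : Σ j, B j}
    (hp : (p.2 : Fin n →₀ ℕ) = d) : f p.1 p.2 ∈ M.piece d := by
  subst hp
  exact h.mem p.1 p.2 p.2.2

/-- The basis elements of degree `d`. -/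
noncomputable def pieceBasis (h : IsBlockBasis M B f) (d : Fin n →₀ ℕ) :
    Module.Basis {p : Σ j, B j // (p.2 : Fin n →₀ ℕ) = d} k (M.piece d) :=
  Module.Basis.mk (v := fun p => ⟨f p.1.1 p.1.2, h.mem_of_eq p.2⟩)
    (LinearIndependent.of_comp (M.piece d).subtype
      (h.linearIndependent.comp _ Subtype.val_injective)) (by
      suffices H : ∀ m : M, M.proj d m ∈ Submodule.span k (Set.range
          fun p : {p : Σ j, B j // (p.2 : Fin n →₀ ℕ) = d} => f p.1.1 p.1.2) by
        rintro ⟨m, hm⟩ -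
        have h1 := H m
        rw [M.proj_of_mem hm] at h1
        have h2 : (Set.range fun p : {p : Σ j, B j // (p.2 : Fin n →₀ ℕ) = d} =>
            f p.1.1 p.1.2) = (M.piece d).subtype ''
              Set.range fun p : {p : Σ j, B j // (p.2 : Fin n →₀ ℕ) = d} =>
                (⟨f p.1.1 p.1.2, h.mem_of_eq p.2⟩ : M.piece d) := by
          rw [← Set.range_comp]; rfl
        rw [h2, ← Submodule.map_span] at h1
        obtain ⟨y, hy, hym⟩ := h1
        obtain rfl : y = ⟨m, hm⟩ := Subtype.ext hym
        exact hy
      intro m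
      have hm := h.span (Submodule.mem_top (x := m))
      induction hm using Submodule.span_induction with
      | mem m hm =>
        obtain ⟨p, rfl⟩ := hm
        by_cases hd : (p.2 : Fin n →₀ ℕ) = d
        · dsimp only
          rw [M.proj_of_mem (h.mem_of_eq hd)]
          exact Submodule.subset_span ⟨⟨p, hd⟩, rfl⟩
        · rw [M.proj_of_mem_ne (h.mem_of_eq rfl) hd]
          exact Submodule.zero_mem _
      | zero => rw [map_zero]; exact Submodule.zero_mem _
      | add x y _ _ hx hy => rw [map_add]; exact Submodule.add_mem _ hx hy
      | smul r x _ hx => rw [map_smul]; exact Submodule.smul_mem _ _ hx)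

theorem coe_pieceBasis (h : IsBlockBasis M B f) (d : Fin n →₀ ℕ)
    (p : {p : Σ j, B j // (p.2 : Fin n →₀ ℕ) = d}) :
    (h.pieceBasis d p : M) = f p.1.1 p.1.2 := by
  rw [pieceBasis, Module.Basis.mk_apply]

/-- The basis elements of `M` of degree `φ d` form a basis of `M_{φ d}`, which is transported to
`N_d`. Since `φ` need not be injective, one element of `M` may give several of `N`, one for each `d`
over its degree. -/
theorem pull {φ : (Fin n →₀ ℕ) → (Fin n →₀ ℕ)} (P : Pullback M N φ) (h : IsBlockBasis M B f) :
    IsBlockBasis N (fun j => φ ⁻¹' B j) (fun j d => P.toFun d (f j (φ d))) := by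
  classical
  let β := N.isInternal.collectedBasis fun d => (h.pieceBasis (φ d)).map (P.equiv d)
  let g : (Σ j, φ ⁻¹' B j) → Σ d, {p : Σ j, B j // (p.2 : Fin n →₀ ℕ) = φ d} :=
    fun p => ⟨p.2, ⟨⟨p.1, ⟨φ p.2, p.2.2⟩⟩, rfl⟩⟩
  have hg : (fun p : Σ j, φ ⁻¹' B j => P.toFun p.2 (f p.1 (φ p.2))) = β ∘ g := by
    funext p
    simp only [β, g, Function.comp_apply, DirectSum.IsInternal.collectedBasis_coe,
      Module.Basis.map_apply]
    rw [Pullback.coe_equiv, coe_pieceBasis]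
  refine ⟨fun j d hd => P.toFun_mem (h.mem j _ hd), ?_, ?_⟩
  · rw [hg]
    refine β.linearIndependent.comp g ?_
    rintro ⟨j, d, hd⟩ ⟨j', d', hd'⟩ hgg
    simp only [g, Sigma.mk.injEq] at hgg
    obtain ⟨rfl, hgg⟩ := hgg
    obtain ⟨rfl, -⟩ := Sigma.mk.inj_iff.1 (congrArg Subtype.val (eq_of_heq hgg))
    rfl
  · rw [hg, Function.Surjective.range_comp, β.span_eq]
    rintro ⟨d, ⟨⟨j, e, he⟩, hp⟩⟩
    change e = φ d at hp
    subst hp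
    exact ⟨⟨j, d, he⟩, rfl⟩

/-- Regroups the same basis: each block is cut into disjoint sub-blocks, and empty blocks may be
dropped. -/
theorem reindex (h : IsBlockBasis M B f) {B' : J' → Set (Fin n →₀ ℕ)}
    {f' : J' → (Fin n →₀ ℕ) → M} (σ : J' → J)
    (hmem : ∀ j, ∀ d ∈ B' j, d ∈ B (σ j) ∧ f' j d = f (σ j) d)
    (hinj : ∀ j₁ j₂ d, d ∈ B' j₁ → d ∈ B' j₂ → σ j₁ = σ j₂ → j₁ = j₂)
    (hsurj : ∀ j, ∀ d ∈ B j, ∃ j', σ j' = j ∧ d ∈ B' j') : IsBlockBasis M B' f' := by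
  let g : (Σ j, B' j) → Σ j, B j := fun p => ⟨σ p.1, ⟨p.2, (hmem p.1 p.2 p.2.2).1⟩⟩
  have hg : (fun p : Σ j, B' j => f' p.1 p.2) = (fun p : Σ j, B j => f p.1 p.2) ∘ g := by
    funext p
    exact (hmem p.1 p.2 p.2.2).2
  refine ⟨fun j d hd => ?_, ?_, ?_⟩
  · rw [(hmem j d hd).2]
    exact h.mem _ d (hmem j d hd).1
  · rw [hg]
    refine h.linearIndependent.comp g ?_
    rintro ⟨j, d, hd⟩ ⟨j', d', hd'⟩ hgg
    have h1 : σ j = σ j' := congrArg Sigma.fst hgg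
    have h2 : d = d' := congrArg (fun p : Σ j, B j => (p.2 : Fin n →₀ ℕ)) hgg
    subst h2
    obtain rfl := hinj j j' d hd hd' h1
    rfl
  · rw [hg, Function.Surjective.range_comp]
    · exact h.span
    · rintro ⟨j, d, hd⟩
      obtain ⟨j', rfl, hd'⟩ := hsurj j d hd
      exact ⟨⟨j', d, hd'⟩, rfl⟩

end IsBlockBasis

end BlockBasis

section QuasiStanley

variable {M : NGradedModule.{u, v} k n} {N : NGradedModule.{u, w} k n} {b : Fin n →₀ ℕ}

theorem QuasiStanleyDecomposition.exists_isBlockBasis {a : Fin n →₀ ℕ}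
    (D : M.QuasiStanleyDecomposition a) : ∃ m : Fin D.size → M,
      IsBlockBasis M (fun j => block a (D.lower j) (D.upper j))
        (fun j d => MvPolynomial.monomial (d - D.lower j) (1 : k) • m j) ∧
      ∀ j, m j ∈ M.piece (D.lower j) := by
  have hl : ∀ j, D.lower j ∈ block a (D.lower j) (D.upper j) := fun j =>
    ⟨le_rfl, fun i _ => D.lower_le_upper j i⟩
  refine ⟨fun j => D.f ⟨j, ⟨D.lower j, hl j⟩⟩, ?_, fun j => D.graded j ⟨_, hl j⟩⟩
  have hf : (fun p : Σ j, block a (D.lower j) (D.upper j) =>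
      MvPolynomial.monomial ((p.2 : Fin n →₀ ℕ) - D.lower p.1) (1 : k) •
        D.f ⟨p.1, ⟨D.lower p.1, hl p.1⟩⟩) = D.f :=
    funext fun p => (D.f_eq p.1 p.2 ⟨_, hl p.1⟩ rfl).symm
  refine ⟨fun j d hd => ?_, ?_, ?_⟩
  · rw [← D.f_eq j ⟨d, hd⟩ ⟨_, hl j⟩ rfl]
    exact D.graded j ⟨d, hd⟩
  · rw [hf]; exact D.f.linearIndependent
  · rw [hf, D.f.span_eq]

theorem IsBlockBasis.shreg_le {J : Type*} [Finite J] {a : Fin n →₀ ℕ}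
    {lower upper : J → Fin n →₀ ℕ} (hlu : ∀ j, lower j ≤ upper j) (hua : ∀ j, upper j ≤ a)
    {m : J → M} (h : IsBlockBasis M (fun j => block a (lower j) (upper j))
      (fun j d => MvPolynomial.monomial (d - lower j) (1 : k) • m j)) {r : ℕ∞}
    (hr : ∀ j, ((lower j).support.card : ℕ∞) ≤ r) : M.shreg ≤ r := by
  obtain ⟨s, ⟨e⟩⟩ := Finite.exists_equiv_fin J
  have h' : IsBlockBasis M (fun j => block a (lower (e.symm j)) (upper (e.symm j)))
      (fun j d => MvPolynomial.monomial (d - lower (e.symm j)) (1 : k) • m (e.symm j)) :=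
    h.reindex e.symm (fun j d hd => ⟨hd, rfl⟩) (fun _ _ _ _ _ h => e.symm.injective h)
      (fun j d hd => ⟨e j, by simp, by simpa using hd⟩)
  let D : M.QuasiStanleyDecomposition a :=
    { size := s
      lower := fun j => lower (e.symm j)
      upper := fun j => upper (e.symm j)
      lower_le_upper := fun j => hlu _
      upper_le := fun j => hua _
      f := Module.Basis.mk h'.linearIndependent h'.span
      graded := fun j d => by
        rw [Module.Basis.mk_apply]
        exact h'.mem j d d.2
      f_eq := fun j d d₀ hd₀ => by
        rw [Module.Basis.mk_apply, Module.Basis.mk_apply]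
        simp only [hd₀, tsub_self, monomial_zero_smul] }
  exact (iInf₂_le a D).trans (iSup_le fun j => hr _)

theorem mem_block {a c u d : Fin n →₀ ℕ} :
    d ∈ block a c u ↔ ∀ i, c i ≤ d i ∧ (u i < a i → d i ≤ u i) :=
  ⟨fun h i => ⟨h.1 i, h.2 i⟩, fun h => ⟨fun i => (h i).1, fun i => (h i).2⟩⟩

theorem slideDeg_le_iff {c b d : Fin n →₀ ℕ} : slideDeg c b ≤ d ↔ c ≤ d - b := by
  refine forall_congr' fun i => ?_
  simp only [slideDeg_apply, Finsupp.tsub_apply]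
  split_ifs <;> omega

theorem slideDeg_tsub (c b : Fin n →₀ ℕ) : slideDeg c b - b = c := by
  ext i
  simp only [slideDeg_apply, Finsupp.tsub_apply]
  split_ifs <;> omega

/-- The preimage of a block under `d ↦ d - b` is one block, with lower corner `c ◁ b` and upper
corner and bound raised by `b`; the lower corner keeps its support. -/
theorem shreg_le_of_pullback (P : Pullback M N (fun d => d - b)) : N.shreg ≤ M.shreg := by
  refine le_iInf₂ fun a D => ?_
  obtain ⟨m, hD, hm⟩ := D.exists_isBlockBasis
  have h := (hD.pull P).reindex (J' := Fin D.size)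
    (B' := fun j => block (a + b) (slideDeg (D.lower j) b) (D.upper j + b))
    (f' := fun j d => MvPolynomial.monomial (d - slideDeg (D.lower j) b) (1 : k) •
      P.toFun (slideDeg (D.lower j) b) (m j)) id (fun j d hd => ⟨?_, ?_⟩)
    (fun _ _ _ _ _ h => h) (fun j d hd => ⟨j, rfl, ?_⟩)
  · refine h.shreg_le (fun j => ?_) (fun j => add_le_add_left (D.upper_le j) b) fun j => ?_
    · rw [slideDeg_le_iff, add_tsub_cancel_right]
      exact D.lower_le_upper j
    · rw [support_slideDeg]
      exact le_iSup (fun j => ((D.lower j).support.card : ℕ∞)) j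
  · refine ⟨slideDeg_le_iff.1 hd.1, fun i hi => ?_⟩
    have := hd.2 i
    simp only [id, Finsupp.add_apply, Finsupp.tsub_apply] at this hi ⊢
    omega
  · have := P.map_monomial hd.1 (m j) (by rw [slideDeg_tsub]; exact hm j)
    rw [slideDeg_tsub] at this
    exact this.symm
  · refine ⟨slideDeg_le_iff.2 hd.1, fun i hi => ?_⟩
    have := hd.2 i
    simp only [Finsupp.add_apply, Finsupp.tsub_apply] at this hi ⊢
    omega

/-- The components of `M` are the components of its slide along `d ↦ d + b`. -/
noncomputable def Pullback.unslide (P : Pullback M N (fun d => d - b)) :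
    Pullback N M (fun d => d + b) :=
  P.ofSection (fun _ _ h => add_le_add_left h b) fun d => add_tsub_cancel_right d b

/-- A generator of degree `c` need not lie in the image of `d ↦ d + b`. It is first multiplied up to
degree `c - b + b`, the coordinatewise maximum of `c` and `b`, and this new element generates the
pulled-back block. -/
theorem Pullback.toFun_monomial_add (Q : Pullback N M (fun d => d + b)) {c d : Fin n →₀ ℕ}
    {y : N} (hy : y ∈ N.piece c) (hd : c - b ≤ d) :
    Q.toFun d (MvPolynomial.monomial (d + b - c) (1 : k) • y) =
      MvPolynomial.monomial (d - (c - b)) (1 : k) •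
        Q.toFun (c - b) (MvPolynomial.monomial (c - b + b - c) (1 : k) • y) := by
  have hmem := N.monomial_smul_mem (c - b + b - c) c y hy
  rw [tsub_add_cancel_of_le le_tsub_add] at hmem
  have := Q.map_monomial hd _ hmem
  rwa [monomial_smul_monomial_smul, tsub_add_tsub_cancel (add_le_add_left hd b) le_tsub_add]
    at this

/-- The preimage of a block under `d ↦ d + b` is obtained by truncated subtraction of `b` from all
corners, which can only shrink the support of the lower one. -/
theorem shreg_le_of_pullback_add (Q : Pullback N M (fun d => d + b)) : M.shreg ≤ N.shreg := by
  refine le_iInf₂ fun a D => ?_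
  obtain ⟨m, hD, hm⟩ := D.exists_isBlockBasis
  have h := (hD.pull Q).reindex
    -- The omitted blocks have a genuine upper bound below `b_i`, so their preimage is empty;
    -- truncation would wrongly make it nonempty.
    (J' := {j : Fin D.size // ∀ i, D.upper j i < a i → b i ≤ D.upper j i})
    (B' := fun j => block (a - b) (D.lower j - b) (D.upper j - b))
    (f' := fun j d => MvPolynomial.monomial (d - (D.lower j - b)) (1 : k) •
      Q.toFun (D.lower j - b) (MvPolynomial.monomial (D.lower j - b + b - D.lower j) (1 : k) •
        m j)) Subtype.val (fun j d hd => ⟨?_, ?_⟩)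
    (fun _ _ _ _ _ h => Subtype.ext h) (fun j d hd => ?_)
  · refine IsBlockBasis.shreg_le (fun j => ?_) (fun j => ?_) h fun j => ?_
    · exact tsub_le_tsub_right (D.lower_le_upper j) b
    · exact tsub_le_tsub_right (D.upper_le j) b
    refine le_trans ?_ (le_iSup (fun j => ((D.lower j).support.card : ℕ∞)) j.1)
    exact_mod_cast Finset.card_le_card fun i hi => by
      simp only [Finsupp.mem_support_iff, Finsupp.tsub_apply] at hi ⊢
      omega
  · rw [Set.mem_preimage, mem_block]
    intro i
    have h1 := mem_block.1 hd i
    have h2 := j.2 i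
    simp only [Finsupp.add_apply, Finsupp.tsub_apply] at h1 ⊢
    omega
  · exact (Q.toFun_monomial_add (hm j) hd.1).symm
  · rw [Set.mem_preimage, mem_block] at hd
    refine ⟨⟨j, fun i hi => ?_⟩, rfl, mem_block.2 fun i => ?_⟩
    · have := hd i
      simp only [Finsupp.add_apply] at this
      omega
    · have := hd i
      simp only [Finsupp.add_apply, Finsupp.tsub_apply] at this ⊢
      omega

theorem shreg_eq (P : Pullback M N (fun d => d - b)) : M.shreg = N.shreg :=
  le_antisymm (shreg_le_of_pullback_add P.unslide) (shreg_le_of_pullback P)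

end QuasiStanley

end NGradedModule

/-! ### Stanley decompositions and Stanley depth. -/

namespace NGradedModule

universe u v w

variable {k : Type u} [Field k] {n : ℕ}

section Stanley

variable {M : NGradedModule.{u, v} k n} {N : NGradedModule.{u, w} k n} {b : Fin n →₀ ℕ}

/-- The degrees of the monomial multiples in `m k[Z]` of an element `m` of degree `c`. -/
def cone (c : Fin n →₀ ℕ) (Z : Finset (Fin n)) : Set (Fin n →₀ ℕ) :=
  {d | c ≤ d ∧ ∀ i ∉ Z, d i = c i}

theorem mem_cone {c d : Fin n →₀ ℕ} {Z : Finset (Fin n)} :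
    d ∈ cone c Z ↔ ∀ i, c i ≤ d i ∧ (i ∉ Z → d i = c i) :=
  ⟨fun h i => ⟨h.1 i, h.2 i⟩, fun h => ⟨fun i => (h i).1, fun i => (h i).2⟩⟩

theorem add_mem_cone {c e : Fin n →₀ ℕ} {Z : Finset (Fin n)} (he : ∀ i ∉ Z, e i = 0) :
    e + c ∈ cone c Z := ⟨le_add_self, fun i hi => by simp [he i hi]⟩

theorem monomial_mem_supported {e : Fin n →₀ ℕ} {Z : Finset (Fin n)} (he : ∀ i ∉ Z, e i = 0) :
    MvPolynomial.monomial e (1 : k) ∈ MvPolynomial.supported k (Z : Set (Fin n)) := by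
  classical
  rw [MvPolynomial.mem_supported, MvPolynomial.vars_monomial one_ne_zero]
  intro i hi
  by_contra hiZ
  simp [he i hiZ] at hi

theorem eq_zero_of_mem_supported {f : MvPolynomial (Fin n) k} {Z : Finset (Fin n)}
    (hf : f ∈ MvPolynomial.supported k (Z : Set (Fin n))) {e : Fin n →₀ ℕ} (he : e ∈ f.support) :
    ∀ i ∉ Z, e i = 0 := by
  intro i hi
  by_contra h
  exact hi (MvPolynomial.mem_supported.1 hf
    ((MvPolynomial.mem_vars_iff_mem_support i).2 ⟨e, he, Finsupp.mem_support_iff.2 h⟩))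

theorem smul_eq_sum (f : MvPolynomial (Fin n) k) (m : M) :
    f • m = ∑ e ∈ f.support, f.coeff e • MvPolynomial.monomial e (1 : k) • m := by
  conv_lhs => rw [f.as_sum, Finset.sum_smul]
  refine Finset.sum_congr rfl fun e _ => ?_
  rw [← smul_assoc, MvPolynomial.smul_monomial, smul_eq_mul, mul_one]

theorem stanleySpace_eq_span (m : M) (c : Fin n →₀ ℕ) (Z : Finset (Fin n)) :
    M.stanleySpace m Z = Submodule.span k
      (Set.range fun d : cone c Z =>
        MvPolynomial.monomial ((d : Fin n →₀ ℕ) - c) (1 : k) • m) := by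
  apply le_antisymm
  · rintro _ ⟨f, hf, rfl⟩
    change f • m ∈ _
    rw [smul_eq_sum]
    refine Submodule.sum_mem _ fun e he => Submodule.smul_mem _ _ (Submodule.subset_span ?_)
    exact ⟨⟨e + c, add_mem_cone (eq_zero_of_mem_supported hf he)⟩, by simp⟩
  · rw [Submodule.span_le]
    rintro _ ⟨d, rfl⟩
    refine ⟨MvPolynomial.monomial ((d : Fin n →₀ ℕ) - c) (1 : k),
      monomial_mem_supported fun i hi => ?_, rfl⟩
    rw [Finsupp.tsub_apply, d.2.2 i hi, tsub_self]

theorem linearIndependent_cone {m : M} (c : Fin n →₀ ℕ) {Z : Finset (Fin n)}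
    (h : ∀ f ∈ MvPolynomial.supported k (Z : Set (Fin n)), f • m = 0 → f = 0) :
    LinearIndependent k fun d : cone c Z =>
      MvPolynomial.monomial ((d : Fin n →₀ ℕ) - c) (1 : k) • m := by
  have hli : LinearIndependent k fun d : cone c Z =>
      MvPolynomial.monomial ((d : Fin n →₀ ℕ) - c) (1 : k) := by
    have h1 := (MvPolynomial.basisMonomials (Fin n) k).linearIndependent.comp
      (fun d : cone c Z => (d : Fin n →₀ ℕ) - c) fun d d' hdd => Subtype.ext (by
        rw [← tsub_add_cancel_of_le d.2.1, ← tsub_add_cancel_of_le d'.2.1]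
        exact congrArg (· + c) hdd)
    rwa [MvPolynomial.coe_basisMonomials] at h1
  refine hli.map (f := (LinearMap.toSpanSingleton (MvPolynomial (Fin n) k) M m).restrictScalars k)
    ?_
  rw [Submodule.disjoint_def]
  intro f hf hfm
  refine h f ?_ hfm
  suffices H : Submodule.span k (Set.range fun d : cone c Z =>
      MvPolynomial.monomial ((d : Fin n →₀ ℕ) - c) (1 : k)) ≤
      Subalgebra.toSubmodule (MvPolynomial.supported k (Z : Set (Fin n))) from H hf
  rw [Submodule.span_le]
  rintro _ ⟨d, rfl⟩
  exact monomial_mem_supported fun i hi => by rw [Finsupp.tsub_apply, d.2.2 i hi, tsub_self]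

theorem StanleyDecomposition.exists_isBlockBasis (D : M.StanleyDecomposition) :
    ∃ c : Fin D.size → Fin n →₀ ℕ, (∀ j, D.gen j ∈ M.piece (c j)) ∧
      IsBlockBasis M (fun j => cone (c j) (D.Z j))
        (fun j d => MvPolynomial.monomial (d - c j) (1 : k) • D.gen j) := by
  classical
  choose c hc using D.homogeneous
  let β := D.isInternal.collectedBasis fun j =>
    (Module.Basis.span (linearIndependent_cone (c j) (D.free j))).map
      (LinearEquiv.ofEq _ _ (stanleySpace_eq_span (D.gen j) (c j) (D.Z j)).symm)
  have hβ : (fun p : Σ j, cone (c j) (D.Z j) =>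
      MvPolynomial.monomial ((p.2 : Fin n →₀ ℕ) - c p.1) (1 : k) • D.gen p.1) = β := by
    funext p
    simp [β, DirectSum.IsInternal.collectedBasis_coe, Module.Basis.span_apply]
  refine ⟨c, hc, fun j d hd => ?_, ?_, ?_⟩
  · have := M.monomial_smul_mem (d - c j) (c j) _ (hc j)
    rwa [tsub_add_cancel_of_le hd.1] at this
  · rw [hβ]; exact β.linearIndependent
  · rw [hβ, β.span_eq]

/-- Linear independence within one cone makes `m_j k[Z_j]` free on `m_j`; independence between cones
makes the sum direct. -/
theorem IsBlockBasis.le_sdepth {J : Type*} [Finite J] {c : J → Fin n →₀ ℕ}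
    {Z : J → Finset (Fin n)} {m : J → M} (hm : ∀ j, m j ∈ M.piece (c j))
    (h : IsBlockBasis M (fun j => cone (c j) (Z j))
      (fun j d => MvPolynomial.monomial (d - c j) (1 : k) • m j)) {r : ℕ∞}
    (hr : ∀ j, r ≤ ((Z j).card : ℕ∞)) : r ≤ M.sdepth := by
  classical
  obtain ⟨s, ⟨e⟩⟩ := Finite.exists_equiv_fin J
  set v := fun p : Σ j, cone (c j) (Z j) =>
    MvPolynomial.monomial ((p.2 : Fin n →₀ ℕ) - c p.1) (1 : k) • m p.1
  have hspace : ∀ j, M.stanleySpace (m j) (Z j) =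
      Submodule.span k (v '' {p | p.1 = j}) := by
    intro j
    rw [stanleySpace_eq_span (m j) (c j) (Z j)]
    congr 1
    ext y
    constructor
    · rintro ⟨d, rfl⟩
      exact ⟨⟨j, d⟩, rfl, rfl⟩
    · rintro ⟨⟨j', d⟩, rfl, rfl⟩
      exact ⟨d, rfl⟩
  let D : M.StanleyDecomposition :=
    { size := s
      gen := fun j => m (e.symm j)
      Z := fun j => Z (e.symm j)
      homogeneous := fun j => ⟨_, hm _⟩
      free := fun j f hf hfm => by
        rw [smul_eq_sum] at hfm
        have hli := h.linearIndependent.comp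
          (fun q : {q : Fin n →₀ ℕ // ∀ i ∉ Z (e.symm j), q i = 0} =>
            (⟨e.symm j, ⟨q + c (e.symm j), add_mem_cone q.2⟩⟩ : Σ j, cone (c j) (Z j)))
          (fun q q' hqq => by
            have := congrArg (fun p : Σ j, cone (c j) (Z j) => (p.2 : Fin n →₀ ℕ)) hqq
            exact Subtype.ext (add_right_cancel this))
        have hli' : LinearIndependent k
            fun q : {q : Fin n →₀ ℕ // ∀ i ∉ Z (e.symm j), q i = 0} =>
              MvPolynomial.monomial (q : Fin n →₀ ℕ) (1 : k) • m (e.symm j) := by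
          convert hli using 2 with q
          simp
        rw [linearIndependent_iff'] at hli'
        have hsum := hli' (f.support.subtype _) (fun q => f.coeff q) (by
          rw [← hfm]
          exact Finset.sum_subtype_of_mem
            (fun q => f.coeff q • MvPolynomial.monomial q (1 : k) • m (e.symm j))
            fun q hq => eq_zero_of_mem_supported hf hq)
        ext q
        by_contra hq
        have hqs := MvPolynomial.mem_support_iff.2 hq
        exact hq (hsum ⟨q, eq_zero_of_mem_supported hf hqs⟩ (Finset.mem_subtype.2 hqs))
      isInternal := by
        refine DirectSum.isInternal_submodule_of_iSupIndep_of_iSup_eq_top ?_ ?_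
        · intro j
          have hd := h.linearIndependent.disjoint_span_image
            (s := {p | p.1 = e.symm j}) (t := {p | p.1 ≠ e.symm j})
            (Set.disjoint_left.2 fun p hp hp' => hp' hp)
          refine hd.mono (hspace _).le (iSup₂_le fun l hl => ?_)
          refine (hspace (e.symm l)).le.trans ?_
          refine Submodule.span_mono (Set.image_mono fun p hp => ?_)
          rw [Set.mem_ofPred_eq] at hp ⊢
          rw [hp]
          exact fun h => hl (e.symm.injective h)
        · rw [eq_top_iff]
          refine h.span.trans (Submodule.span_le.2 ?_)
          rintro _ ⟨p, rfl⟩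
          refine Submodule.mem_iSup_of_mem (e p.1) ?_
          rw [hspace, e.symm_apply_apply]
          exact Submodule.subset_span ⟨p, rfl, rfl⟩ }
  exact le_iSup_of_le D (le_iInf fun j => hr _)

/-- The preimage of a cone under `d ↦ d - b` need not be a cone: in a direction `i ∉ Z` with `c_i =
0`, all values from `0` to `b_i` occur. Fixing these values cuts it into finitely many cones with
the same `Z`. -/
theorem sdepth_le_of_pullback (P : Pullback M N (fun d => d - b)) : M.sdepth ≤ N.sdepth := by
  classical
  refine iSup_le fun D => ?_
  obtain ⟨c, hc, hD⟩ := D.exists_isBlockBasis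
  -- The vector `s` lists the chosen values in those directions; the cone then starts at `c ◁ b +
  -- s`.
  let J := Σ j : Fin D.size, {s : Fin n →₀ ℕ // s ≤ b ∧ ∀ i, s i ≠ 0 → i ∉ D.Z j ∧ c j i = 0}
  have hfin : ∀ j, Finite {s : Fin n →₀ ℕ // s ≤ b ∧ ∀ i, s i ≠ 0 → i ∉ D.Z j ∧ c j i = 0} :=
    fun j => ((Set.finite_Iic b).subset fun s hs => hs.1).to_subtype
  have hJ : Finite J := inferInstance
  have hval : ∀ (p : J) i, (slideDeg (c p.1) b + p.2.1) i =
      if c p.1 i = 0 then p.2.1 i else c p.1 i + b i := by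
    intro p i
    have h1 := p.2.2.2 i
    rw [Finsupp.add_apply, slideDeg_apply]
    split_ifs <;> omega
  have hsub : ∀ p : J, slideDeg (c p.1) b + p.2.1 - b = c p.1 := by
    intro p
    ext i
    have h1 := p.2.2.1 i
    rw [Finsupp.tsub_apply, hval]
    split_ifs <;> omega
  have hmem : ∀ p : J, D.gen p.1 ∈ M.piece (slideDeg (c p.1) b + p.2.1 - b) := fun p => by
    rw [hsub]; exact hc p.1
  have h := (hD.pull P).reindex (J' := J)
    (B' := fun p => cone (slideDeg (c p.1) b + p.2.1) (D.Z p.1))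
    (f' := fun p d => MvPolynomial.monomial (d - (slideDeg (c p.1) b + p.2.1)) (1 : k) •
      P.toFun (slideDeg (c p.1) b + p.2.1) (D.gen p.1)) Sigma.fst
    (fun p d hd => ⟨?_, ?_⟩) (fun p q d hp hq hpq => ?_) (fun j d hd => ?_)
  · exact h.le_sdepth (fun p => P.toFun_mem (hmem p)) fun p =>
      iInf_le (fun j => ((D.Z j).card : ℕ∞)) p.1
  · rw [Set.mem_preimage, mem_cone]
    intro i
    have h1 := mem_cone.1 hd i
    have h2 := p.2.2.1 i
    have h3 := p.2.2.2 i
    rw [hval] at h1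
    rw [Finsupp.tsub_apply]
    grind
  · have := P.map_monomial hd.1 (D.gen p.1) (hmem p)
    rw [hsub] at this
    exact this.symm
  · obtain ⟨j, s, hs⟩ := p
    obtain ⟨j', s', hs'⟩ := q
    obtain rfl : j = j' := hpq
    suffices s = s' by subst this; rfl
    ext i
    have h1 := mem_cone.1 hp i
    have h2 := mem_cone.1 hq i
    rw [hval] at h1 h2
    have h3 := hs.2 i
    have h4 := hs'.2 i
    dsimp only at h1 h2
    by_cases hi : i ∉ D.Z j ∧ c j i = 0
    · rw [if_pos hi.2] at h1 h2
      rw [← h1.2 hi.1, h2.2 hi.1]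
    · rw [not_not.1 (mt h3 hi), not_not.1 (mt h4 hi)]
  · rw [Set.mem_preimage, mem_cone] at hd
    -- The piece containing `d` is found by reading off its coordinates in the collapsed directions.
    refine ⟨⟨j, ⟨d.filter fun i => i ∉ D.Z j ∧ c j i = 0, fun i => ?_, fun i hi => ?_⟩⟩, rfl,
      mem_cone.2 fun i => ?_⟩
    · have h1 := hd i
      rw [Finsupp.tsub_apply] at h1
      rw [Finsupp.filter_apply]
      grind
    · by_contra hcon
      exact hi (Finsupp.filter_apply_neg _ _ hcon)
    · have h1 := hd i
      rw [Finsupp.tsub_apply] at h1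
      rw [hval]
      dsimp only
      rw [Finsupp.filter_apply]
      grind

/-- The preimage of a cone under `d ↦ d + b` is a single cone with the same `Z`, or empty when some
`i ∉ Z` has `c_i < b_i`; the latter indices are dropped. -/
theorem sdepth_le_of_pullback_add (Q : Pullback N M (fun d => d + b)) : N.sdepth ≤ M.sdepth := by
  refine iSup_le fun D => ?_
  obtain ⟨c, hc, hD⟩ := D.exists_isBlockBasis
  have h := (hD.pull Q).reindex
    (J' := {j : Fin D.size // ∀ i ∉ D.Z j, b i ≤ c j i})
    (B' := fun j => cone (c j - b) (D.Z j))
    (f' := fun j d => MvPolynomial.monomial (d - (c j - b)) (1 : k) •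
      Q.toFun (c j - b) (MvPolynomial.monomial (c j - b + b - c j) (1 : k) • D.gen j))
    Subtype.val (fun j d hd => ⟨?_, ?_⟩) (fun _ _ _ _ _ h => Subtype.ext h) (fun j d hd => ?_)
  · refine IsBlockBasis.le_sdepth (fun j => Q.toFun_mem ?_) h fun j =>
      iInf_le (fun j => ((D.Z j).card : ℕ∞)) j.1
    have := N.monomial_smul_mem (c j - b + b - c j) (c j) _ (hc j)
    rwa [tsub_add_cancel_of_le le_tsub_add] at this
  · rw [Set.mem_preimage, mem_cone]
    intro i
    have h1 := mem_cone.1 hd i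
    have h2 := j.2 i
    simp only [Finsupp.add_apply, Finsupp.tsub_apply] at h1 ⊢
    grind
  · exact (Q.toFun_monomial_add (hc j) hd.1).symm
  · rw [Set.mem_preimage, mem_cone] at hd
    refine ⟨⟨j, fun i hi => ?_⟩, rfl, mem_cone.2 fun i => ?_⟩
    · have := hd i
      simp only [Finsupp.add_apply] at this
      grind
    · have := hd i
      simp only [Finsupp.add_apply, Finsupp.tsub_apply] at this ⊢
      grind

theorem sdepth_eq (P : Pullback M N (fun d => d - b)) : M.sdepth = N.sdepth :=
  le_antisymm (sdepth_le_of_pullback P) (sdepth_le_of_pullback_add P.unslide)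

end Stanley

end NGradedModule

theorem proposition5p2 {k : Type*} [Field k] {n : ℕ} (M : NGradedModule k n)
    (hM : Module.Finite (MvPolynomial (Fin n) k) M) (b : Fin n →₀ ℕ) :
    (∃ c : Fin n →₀ ℕ, M.IsPosDetermined c) ∧
    ∀ c : Fin n →₀ ℕ, M.IsPosDetermined c →
      (∀ (i : ℕ) (a : Fin n →₀ ℕ),
        M.betti i a = (M.slide c b).betti i (NGradedModule.slideDeg a b)) ∧
      M.dim = (M.slide c b).dim ∧
      M.depth = (M.slide c b).depth ∧
      M.sreg = (M.slide c b).sreg ∧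
      M.sdepth = (M.slide c b).sdepth ∧
      M.shreg = (M.slide c b).shreg := by
  refine ⟨M.exists_isPosDetermined, fun c hc => ?_⟩
  have P := M.slidePullback hc b
  have := NGradedModule.finite_of_pullback P hc
  exact ⟨NGradedModule.betti_slideDeg P, NGradedModule.dim_eq P, NGradedModule.depth_eq P,
    NGradedModule.sreg_eq P, NGradedModule.sdepth_eq P, NGradedModule.shreg_eq P⟩
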